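/- Let $k\ge 3$, $p\ge 1$, $n$ be natural numbers, let $\theta_{\min},D,\eta,\alpha,C_{\min}>0$ and $0<\delta<1$. Let $\Theta^0\in\mathbb R^{p\times p}$ be such that every row has at most $k$ nonzero entries, every nonzero entry has absolute value at least $\theta_{\min}$, and $$\frac{1-\sigma_{\max}(I+\eta\Theta^0)}{\eta}\ \ge\ D,$$ where $\sigma_{\max}$ denotes the largest singular value. Let $Q^0\in\mathbb R^{p\times p}$ be the solution of $$\Theta^0Q^0+Q^0(\Theta^0)^*+\eta\,\Theta^0Q^0(\Theta^0)^*+I=0 .$$ Fix a row index $r$, let $S$ be the support of the $r$-th row $\Theta^0_r$ and $S^C$ its complement, and assume $$\lambda_{\min}\big(Q^0_{S,S}\big)\ge C_{\min},\qquad \big|\!\big|\!\big|\,Q^0_{S^C,S}\,(Q^0_{S,S})^{-1}\big|\!\big|\!\big|_\infty\le 1-\alpha ,$$ where $|\!|\!|M|\!|\!|_\infty$ is the largest $\ell_1$ norm of a row of $M$ ($0$ if $M$ has no rows). Let $x(t)$, $t\ge 0$, be a stationary trajectory of $$x(t)=x(t-1)+\eta\,\Theta^0x(t-1)+w(t),\qquad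 t\ge 1,$$ where the $w(t)$ are i.i.d. $\mathsf N(0,\eta I_{p\times p})$ and independent of $x(0)$. If $$n\eta>\frac{10^4k^2\,(kD^{-2}+\theta_{\min}^{-2})}{\alpha^2\,D\,C_{\min}^2}\,\log\Big(\frac{4pk}{\delta}\Big),$$ then for $$\lambda=\sqrt{\frac{36\,\log(4p/\delta)}{D\,\alpha^2\,n\eta}}>0$$ the following event has probability larger than $1-\delta$: the problem $$\underset{\theta\in\mathbb R^p}{\text{minimize}}\quad \frac1{2\eta^2n}\sum_{t=0}^{n-1}\big\{x_r(t+1)-x_r(t)-\eta\langle\theta,x(t)\rangle\big\}^2+\lambda\|\theta\|_1$$ has a solution, and every solution $\widehat\theta$ satisfies $\mathrm{sign}(\widehat\theta)=\mathrm{sign}(\Theta^0_r)$ entrywise, where $\mathrm{sign}$ takes values in $\{-1,0,1\}$. (The step size $\eta$ enters the sample condition and $\lambda$ only through the product $n\eta$, so the guarantee is uniform as $\eta\to0$ with $n\eta$ fixed.) -/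

import Mathlib

open MeasureTheory ProbabilityTheory

noncomputable section

/-- The largest singular value of a real square matrix, i.e. its `ℓ₂` operator norm. -/
def sigmaMax {p : ℕ} (A : Matrix (Fin p) (Fin p) ℝ) : ℝ :=
  ‖Matrix.toEuclideanCLM (𝕜 := ℝ) A‖

/-- The `ℓ_∞` operator norm of a real matrix: the largest `ℓ₁` norm of a row
(equal to `0` for a matrix without rows). -/
def infOpNorm {m n : Type*} [Fintype n] (M : Matrix m n ℝ) : ℝ :=
  ⨆ i, ∑ j, |M i j|

/-- The support of row `r` of `Θ`. -/
def rowSupport {p : ℕ} (Θ : Matrix (Fin p) (Fin p) ℝ) (r : Fin p) : Finset (Fin p) :=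
  Finset.univ.filter (fun j => Θ r j ≠ 0)

/-- The class of sparse drift matrices for the discrete-time model with step size `η`:
at most `k` nonzero entries in each row, nonzero entries of absolute value at least `θmin`, and
contraction rate `(1 - σ_max (I + η Θ)) / η` at least `D`. -/
structure SparseClass (k p : ℕ) (θmin D η : ℝ) (Θ : Matrix (Fin p) (Fin p) ℝ) : Prop where
  row_card : ∀ r, (rowSupport Θ r).card ≤ k
  entry_ge : ∀ i j, Θ i j ≠ 0 → θmin ≤ |Θ i j|
  contraction : D ≤ (1 - sigmaMax (1 + η • Θ)) / η

/-- The discrete-time Lyapunov equation that determines the covariance matrix of the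
stationary law. -/
def LyapunovEq {p : ℕ} (η : ℝ) (Θ Q : Matrix (Fin p) (Fin p) ℝ) : Prop :=
  Θ * Q + Q * Θ.transpose + η • (Θ * Q * Θ.transpose) + 1 = 0

/-- Restricted convexity on an index set `S`: the smallest eigenvalue of `Q_{S,S}` is at least
`Cmin`, that is, all its eigenvalues are. -/
def RestrictedConvexity {p : ℕ} (Q : Matrix (Fin p) (Fin p) ℝ) (S : Finset (Fin p))
    (Cmin : ℝ) : Prop :=
  ∀ μ ∈ spectrum ℝ (Q.toBlock (· ∈ S) (· ∈ S)), Cmin ≤ μ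

/-- Irrepresentability on an index set `S`: the `ℓ_∞` operator norm of
`Q_{Sᶜ,S} (Q_{S,S})⁻¹` is at most `1 - α`. -/
def Irrepresentability {p : ℕ} (Q : Matrix (Fin p) (Fin p) ℝ) (S : Finset (Fin p))
    (α : ℝ) : Prop :=
  infOpNorm (Q.toBlock (· ∉ S) (· ∈ S) * (Q.toBlock (· ∈ S) (· ∈ S))⁻¹) ≤ 1 - α

/-- `x` is a stationary trajectory of `x(t) = x(t-1) + η Θ x(t-1) + w(t)`, `t ≥ 1`: the noise
coordinates `w_i(t)` are independent centred Gaussians of variance `η`, the initial state is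
independent of the noise, and all `x(t)` have the same law. -/
structure StationaryTrajectory {p : ℕ} {Ω : Type*} [MeasurableSpace Ω] (P : Measure Ω)
    (η : ℝ) (Θ : Matrix (Fin p) (Fin p) ℝ) (x w : ℕ → Ω → Fin p → ℝ) : Prop where
  meas_init : Measurable (x 0)
  meas_noise : ∀ t, Measurable (w (t + 1))
  noise_law : ∀ t i, HasLaw (fun ω => w (t + 1) ω i) (gaussianReal 0 η.toNNReal) P
  noise_indep : iIndepFun (fun (a : ℕ × Fin p) ω => w (a.1 + 1) ω a.2) P
  init_indep : IndepFun (x 0) (fun ω (t : ℕ) => w (t + 1) ω) P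
  step : ∀ t ω, x (t + 1) ω = x t ω + η • Θ.mulVec (x t ω) + w (t + 1) ω
  stationary : ∀ t, IdentDistrib (x t) (x 0) P P

/-- The normalized sum of squares
`(2 η² n)⁻¹ ∑_{t<n} (y_r(t+1) - y_r(t) - η ⟨θ, y(t)⟩)²` of a path `y` at `θ`. -/
def lsCost {p : ℕ} (η : ℝ) (n : ℕ) (y : ℕ → Fin p → ℝ) (r : Fin p) (θ : Fin p → ℝ) : ℝ :=
  1 / (2 * η ^ 2 * n) *
    ∑ t ∈ Finset.range n, (y (t + 1) r - y t r - η * ∑ j, θ j * y t j) ^ 2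

/-- `θ` solves the `ℓ₁`-regularized least squares problem for row `r`, with data
`y(0), …, y(n)` and regularization parameter `lam`. -/
def IsRlsSolution {p : ℕ} (η : ℝ) (n : ℕ) (y : ℕ → Fin p → ℝ) (r : Fin p) (lam : ℝ)
    (θ : Fin p → ℝ) : Prop :=
  ∀ θ' : Fin p → ℝ,
    lsCost η n y r θ + lam * ∑ j, |θ j| ≤ lsCost η n y r θ' + lam * ∑ j, |θ' j|

/-- `ℓ₁`-regularized least squares recovers the signed support of `θ₀`: the problem has a
solution, and every solution has the same signs as `θ₀`. -/
def RlsRecoversSign {p : ℕ} (η : ℝ) (n : ℕ) (y : ℕ → Fin p → ℝ) (r : Fin p) (lam : ℝ)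
    (θ₀ : Fin p → ℝ) : Prop :=
  (∃ θ, IsRlsSolution η n y r lam θ) ∧
    ∀ θ, IsRlsSolution η n y r lam θ → ∀ j, SignType.sign (θ j) = SignType.sign (θ₀ j)

end

/-! The proof is a primal-dual witness argument on top of two concentration bounds.

Deterministic part. Put `A = 1 + η • Θ`. The cost is quadratic, its Hessian is the empirical second
moment matrix `empCov`, and its negative gradient at the true row is `empGrad`. If `empCov` is
entrywise close to `Q` on the rows indexed by `S`, and `empGrad` is at most `lam * α / 3`, then the
stationarity equation restricted to `S` has a solution close enough to the truth to keep every sign,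
and irrepresentability keeps the dual variable strictly below `lam` off `S`. This is
`rlsRecoversSign_of_close`; strictness forces every minimizer to coincide with the witness
(`rlsRecoversSign_of_kkt`).

Second moments. Iterating the Lyapunov equation gives `Q = η ∑ A^l (Aᵀ)^l`, whence symmetry,
positivity and `Q ≤ 1/D`; iterating stationarity on characteristic functions shows that `x 0` is
centred Gaussian with covariance `Q`. To bound the exponential moment of `s ∑ ⟨v, x t⟩²`, the noise
is integrated out from the last time backwards. The exponent stays a quadratic form in the current
state: the discounted energy `∑ ρ^l ⟨(Aᵀ)^l v, z⟩²`, where `ρ` absorbs the factor lost in each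
Gaussian integration. Each integration costs a logarithm governed by the trace of the energy, and
`η` times that trace is close to `⟨v, Q v⟩`. The outcome, `lintegral_exp_sum_sq_le`, has variance
proxy of order `n / (η D³)`, so that after Chernoff only `n * η` enters. Polarization passes from
directions to entries.

Gradient. The noise is independent of the past, so the sum in `empGrad` is a martingale; its
exponential supermartingale gives a Gaussian tail wherever the empirical variance is at most `2 /
D`. A union bound over `k * p` covariance entries, `p` variances and `p` gradient coordinates
concludes. -/

/-! ### Deterministic recovery for the regularized least squares problem -/

/-- The empirical second moment matrix of the path `y`. -/
noncomputable def empCov {p : ℕ} (n : ℕ) (y : ℕ → Fin p → ℝ) (i j : Fin p) : ℝ :=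
  (1 / n : ℝ) * ∑ t ∈ Finset.range n, y t i * y t j

/-- The negative gradient of the least squares cost at the true parameter, for noise `ξ`. -/
noncomputable def empGrad {p : ℕ} (η : ℝ) (n : ℕ) (ξ : ℕ → ℝ) (y : ℕ → Fin p → ℝ)
    (j : Fin p) : ℝ :=
  (1 / (n * η) : ℝ) * ∑ t ∈ Finset.range n, ξ t * y t j

lemma sum_mul_empCov {p : ℕ} (n : ℕ) (y : ℕ → Fin p → ℝ) (u : Fin p → ℝ) (j : Fin p) :
    ∑ i, u i * empCov n y i j
      = (1 / n : ℝ) * ∑ t ∈ Finset.range n, (∑ i, u i * y t i) * y t j := by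
  simp only [empCov, Finset.mul_sum, Finset.sum_mul]
  rw [Finset.sum_comm]
  refine Finset.sum_congr rfl fun t _ => Finset.sum_congr rfl fun i _ => by ring

lemma quadForm_empCov {p : ℕ} (n : ℕ) (y : ℕ → Fin p → ℝ) (u v : Fin p → ℝ) :
    ∑ j, v j * ∑ i, u i * empCov n y i j
      = (1 / n : ℝ) * ∑ t ∈ Finset.range n, (∑ i, u i * y t i) * (∑ i, v i * y t i) := by
  simp only [sum_mul_empCov, Finset.mul_sum]
  rw [Finset.sum_comm]
  refine Finset.sum_congr rfl fun t _ => Finset.sum_congr rfl fun i _ => by ring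

lemma sum_mul_empGrad {p : ℕ} (η : ℝ) (n : ℕ) (ξ : ℕ → ℝ) (y : ℕ → Fin p → ℝ)
    (u : Fin p → ℝ) :
    ∑ j, u j * empGrad η n ξ y j
      = (1 / (n * η) : ℝ) * ∑ t ∈ Finset.range n, ξ t * ∑ i, u i * y t i := by
  simp only [empGrad, Finset.mul_sum]
  rw [Finset.sum_comm]
  refine Finset.sum_congr rfl fun t _ => Finset.sum_congr rfl fun i _ => by ring

/-- A quadratic function equals its second order expansion; the bracket is minus the gradient at
`θ`, so the optimality conditions can be read off without any calculus. -/
lemma lsCost_sub {p : ℕ} {η : ℝ} (hη : η ≠ 0) {n : ℕ} (hn : n ≠ 0) {y : ℕ → Fin p → ℝ}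
    {ξ : ℕ → ℝ} {r : Fin p} {θ₀ : Fin p → ℝ}
    (hy : ∀ t, y (t + 1) r - y t r = η * ∑ j, θ₀ j * y t j + ξ t) (θ θ' : Fin p → ℝ) :
    lsCost η n y r θ' - lsCost η n y r θ
      = 1 / (2 * n) * ∑ t ∈ Finset.range n, (∑ j, (θ' j - θ j) * y t j) ^ 2
        - ∑ j, (θ' j - θ j) *
            (empGrad η n ξ y j - ∑ i, (θ i - θ₀ i) * empCov n y i j) := by
  have hn' : (n : ℝ) ≠ 0 := by exact_mod_cast hn
  simp only [mul_sub (_ - _) (empGrad _ _ _ _ _), Finset.sum_sub_distrib]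
  rw [quadForm_empCov, sum_mul_empGrad]
  simp only [lsCost, Finset.mul_sum (Finset.range n)]
  rw [← Finset.sum_sub_distrib, ← Finset.sum_sub_distrib, ← Finset.sum_sub_distrib]
  refine Finset.sum_congr rfl fun t _ => ?_
  rw [hy t]
  simp only [sub_mul, Finset.sum_sub_distrib]
  field_simp
  ring

/-- Strict first order conditions together with definiteness on the support give recovery of
the signed support. -/
lemma rlsRecoversSign_of_kkt {p : ℕ} {η : ℝ} (hη : η ≠ 0) {n : ℕ} (hn : n ≠ 0)
    {y : ℕ → Fin p → ℝ} {ξ : ℕ → ℝ} {r : Fin p} {θ₀ : Fin p → ℝ} {lam : ℝ} (hlam : 0 < lam)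
    (hy : ∀ t, y (t + 1) r - y t r = η * ∑ j, θ₀ j * y t j + ξ t)
    (hpd : ∀ u : Fin p → ℝ, (∀ j, θ₀ j = 0 → u j = 0) →
      ∑ t ∈ Finset.range n, (∑ j, u j * y t j) ^ 2 = 0 → u = 0)
    (θ : Fin p → ℝ) (hsign : ∀ j, SignType.sign (θ j) = SignType.sign (θ₀ j))
    (hon : ∀ j, θ₀ j ≠ 0 → empGrad η n ξ y j - ∑ i, (θ i - θ₀ i) * empCov n y i j
      = lam * (SignType.sign (θ₀ j) : ℝ))
    (hoff : ∀ j, θ₀ j = 0 →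
      |empGrad η n ξ y j - ∑ i, (θ i - θ₀ i) * empCov n y i j| < lam) :
    RlsRecoversSign η n y r lam θ₀ := by
  set g : Fin p → ℝ := fun j => empGrad η n ξ y j - ∑ i, (θ i - θ₀ i) * empCov n y i j with hg
  have hzero : ∀ j, θ₀ j = 0 → θ j = 0 := fun j hj => by
    have := hsign j
    rw [hj, sign_zero] at this
    exact sign_eq_zero_iff.1 this
  have hn0 : (0 : ℝ) < n := by exact_mod_cast Nat.pos_of_ne_zero hn
  -- The excess of the objective splits into a square and, coordinate by coordinate, the gap in the
  -- subgradient inequality for `lam * |·|` at `θ j` with slope `g j`. Both parts are nonnegative.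
  have key : ∀ θ' : Fin p → ℝ,
      (lsCost η n y r θ' + lam * ∑ j, |θ' j|) - (lsCost η n y r θ + lam * ∑ j, |θ j|)
        = 1 / (2 * n) * ∑ t ∈ Finset.range n, (∑ j, (θ' j - θ j) * y t j) ^ 2
          + ∑ j, (lam * |θ' j| - lam * |θ j| - (θ' j - θ j) * g j) := by
    intro θ'
    have := lsCost_sub hη hn hy θ θ'
    change _ = _ - ∑ j, (θ' j - θ j) * g j at this
    rw [Finset.sum_sub_distrib, Finset.sum_sub_distrib, ← Finset.mul_sum, ← Finset.mul_sum]
    linarith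
  have hterm : ∀ (θ' : Fin p → ℝ) j, 0 ≤ lam * |θ' j| - lam * |θ j| - (θ' j - θ j) * g j := by
    intro θ' j
    by_cases hj : θ₀ j = 0
    · have h1 := hoff j hj
      rw [hzero j hj]
      have h2 : θ' j * g j ≤ |θ' j| * |g j| := by rw [← abs_mul]; exact le_abs_self _
      have h3 : |θ' j| * |g j| ≤ |θ' j| * lam :=
        mul_le_mul_of_nonneg_left h1.le (abs_nonneg _)
      simp only [abs_zero, sub_zero, mul_zero]
      linarith
    · have h1 : g j = lam * (SignType.sign (θ₀ j) : ℝ) := hon j hj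
      rw [h1, ← hsign j]
      have h2 : θ j * (SignType.sign (θ j) : ℝ) = |θ j| := self_mul_sign _
      have h3 : θ' j * (SignType.sign (θ j) : ℝ) ≤ |θ' j| := by
        rcases SignType.sign (θ j) with _ | _ | _
        · simp
        · simpa using neg_le_abs (θ' j)
        · simpa using le_abs_self (θ' j)
      nlinarith
  refine ⟨⟨θ, fun θ' => ?_⟩, fun θ' hθ' => ?_⟩
  · have h1 := key θ'
    have h2 : 0 ≤ ∑ j, (lam * |θ' j| - lam * |θ j| - (θ' j - θ j) * g j) :=
      Finset.sum_nonneg fun j _ => hterm θ' j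
    have h3 : 0 ≤ 1 / (2 * n : ℝ) * ∑ t ∈ Finset.range n, (∑ j, (θ' j - θ j) * y t j) ^ 2 :=
      mul_nonneg (by positivity) (Finset.sum_nonneg fun _ _ => sq_nonneg _)
    linarith
  · have h1 := key θ'
    have h0 := hθ' θ
    have h2 : 0 ≤ ∑ j, (lam * |θ' j| - lam * |θ j| - (θ' j - θ j) * g j) :=
      Finset.sum_nonneg fun j _ => hterm θ' j
    have h3 : 0 ≤ ∑ t ∈ Finset.range n, (∑ j, (θ' j - θ j) * y t j) ^ 2 :=
      Finset.sum_nonneg fun _ _ => sq_nonneg _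
    have h3' : 0 ≤ 1 / (2 * n : ℝ) * ∑ t ∈ Finset.range n, (∑ j, (θ' j - θ j) * y t j) ^ 2 :=
      mul_nonneg (by positivity) h3
    have h4 : ∑ j, (lam * |θ' j| - lam * |θ j| - (θ' j - θ j) * g j) = 0 := by linarith
    have h5 : 1 / (2 * n : ℝ) * ∑ t ∈ Finset.range n, (∑ j, (θ' j - θ j) * y t j) ^ 2 = 0 := by
      linarith
    have h6 : ∑ t ∈ Finset.range n, (∑ j, (θ' j - θ j) * y t j) ^ 2 = 0 := by
      rcases mul_eq_zero.1 h5 with h | h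
      · exact absurd h (by positivity)
      · exact h
    rw [Finset.sum_eq_zero_iff_of_nonneg fun j _ => hterm θ' j] at h4
    -- For another minimizer both parts vanish. A zero gap together with `|g j| < lam` kills every
    -- coordinate off the support, so definiteness on the support applies to the difference.
    have h7 : (fun j => θ' j - θ j) = 0 := by
      refine hpd _ (fun j hj => ?_) h6
      have h8 := h4 j (Finset.mem_univ j)
      have h9 := hoff j hj
      rw [hzero j hj] at h8 ⊢
      simp only [abs_zero, sub_zero, mul_zero] at h8 ⊢
      have h10 : θ' j * g j ≤ |θ' j| * |g j| := by rw [← abs_mul]; exact le_abs_self _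
      by_contra hne
      have h11 : |θ' j| * |g j| < |θ' j| * lam := mul_lt_mul_of_pos_left h9 (abs_pos.2 hne)
      linarith
    intro j
    have : θ' j = θ j := sub_eq_zero.1 (congrFun h7 j)
    rw [this, hsign j]

/-- A form that is definite on `S` can be inverted on `S`. -/
lemma exists_solution_on_support {p : ℕ} (S : Finset (Fin p)) (M : Fin p → Fin p → ℝ) {m : ℝ}
    (hm : 0 < m)
    (hM : ∀ u : Fin p → ℝ, (∀ j, j ∉ S → u j = 0) →
      m * ∑ j, u j ^ 2 ≤ ∑ j, u j * ∑ i, u i * M i j) (b : Fin p → ℝ) :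
    ∃ d : Fin p → ℝ, (∀ j, j ∉ S → d j = 0) ∧ ∀ j ∈ S, ∑ i, d i * M i j = b j := by
  classical
  let N : Matrix {i // i ∈ S} {i // i ∈ S} ℝ := Matrix.of fun j i => M i j
  let ext : ({i // i ∈ S} → ℝ) → Fin p → ℝ := fun u i => if h : i ∈ S then u ⟨i, h⟩ else 0
  have hext0 : ∀ u j, j ∉ S → ext u j = 0 := fun u j hj => by simp [ext, hj]
  have hext1 : ∀ u (j : {i // i ∈ S}), ext u j = u j := fun u j => by simp [ext]
  have hsum : ∀ (u : {i // i ∈ S} → ℝ) (f : Fin p → ℝ),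
      ∑ i, ext u i * f i = ∑ i : {i // i ∈ S}, u i * f i := by
    intro u f
    rw [← Finset.sum_subset (Finset.subset_univ S)
      (fun i _ hi => by rw [hext0 u i hi, zero_mul]), ← Finset.sum_coe_sort]
    exact Finset.sum_congr rfl fun i _ => by rw [hext1]
  have hmul : ∀ u (j : {i // i ∈ S}), N.mulVec u j = ∑ i, ext u i * M i j := by
    intro u j
    rw [hsum]
    simp [N, Matrix.mulVec, dotProduct, mul_comm]
  have hinj : Function.Injective N.mulVec := by
    refine (injective_iff_map_eq_zero N.mulVecLin).2 fun u hu => ?_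
    have h1 := hM (ext u) (hext0 u)
    have h2 : ∑ j, ext u j * ∑ i, ext u i * M i j = 0 := by
      rw [hsum]
      refine Finset.sum_eq_zero fun j _ => ?_
      have : N.mulVec u j = 0 := congrFun hu j
      rw [hmul] at this
      rw [this, mul_zero]
    have h3 : ∑ j, ext u j ^ 2 = 0 :=
      le_antisymm (by nlinarith) (Finset.sum_nonneg fun _ _ => sq_nonneg _)
    rw [Finset.sum_eq_zero_iff_of_nonneg fun _ _ => sq_nonneg _] at h3
    funext j
    have := h3 j (Finset.mem_univ _)
    rw [hext1] at this
    simpa using this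
  have hsurj : Function.Surjective N.mulVec :=
    Matrix.mulVec_surjective_iff_isUnit.2 (Matrix.mulVec_injective_iff_isUnit.1 hinj)
  obtain ⟨u, hu⟩ := hsurj fun j => b j
  refine ⟨ext u, hext0 u, fun j hj => ?_⟩
  rw [← hmul u ⟨j, hj⟩, hu]

lemma abs_sum_mul_le {ι : Type*} {s : Finset ι} {u f : ι → ℝ} {c : ℝ} (h : ∀ i ∈ s, |f i| ≤ c) :
    |∑ i ∈ s, u i * f i| ≤ (∑ i ∈ s, |u i|) * c := by
  rw [Finset.sum_mul]
  refine (Finset.abs_sum_le_sum_abs _ _).trans (Finset.sum_le_sum fun i hi => ?_)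
  rw [abs_mul]
  exact mul_le_mul_of_nonneg_left (h i hi) (abs_nonneg _)

lemma sum_eq_sum_support {p : ℕ} {S : Finset (Fin p)} {u : Fin p → ℝ}
    (hu : ∀ j, j ∉ S → u j = 0) (f : Fin p → ℝ) : ∑ i, u i * f i = ∑ i ∈ S, u i * f i :=
  (Finset.sum_subset (Finset.subset_univ S) fun i _ hi => by rw [hu i hi, zero_mul]).symm

lemma sq_sum_abs_le_of_support {p : ℕ} {S : Finset (Fin p)} {k : ℝ} (hS : (S.card : ℝ) ≤ k)
    {u : Fin p → ℝ} (hu : ∀ j, j ∉ S → u j = 0) :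
    (∑ i, |u i|) ^ 2 ≤ k * ∑ i, u i ^ 2 := by
  have h1 : ∑ i, |u i| = ∑ i ∈ S, |u i| :=
    (Finset.sum_subset (Finset.subset_univ S) fun i _ hi => by rw [hu i hi, abs_zero]).symm
  have h2 : ∑ i, u i ^ 2 = ∑ i ∈ S, |u i| ^ 2 := by
    simp only [sq_abs]
    exact (Finset.sum_subset (Finset.subset_univ S)
      fun i _ hi => by rw [hu i hi]; simp).symm
  rw [h1, h2]
  exact (sq_sum_le_card_mul_sum_sq).trans
    (mul_le_mul_of_nonneg_right hS (Finset.sum_nonneg fun _ _ => sq_nonneg _))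

/-- Perturbation of a quadratic form restricted to vectors supported on `S`. -/
lemma quadForm_perturb {p : ℕ} {S : Finset (Fin p)} {k : ℝ} (hS : (S.card : ℝ) ≤ k) {ε c : ℝ}
    (hε : 0 ≤ ε) {M M' : Fin p → Fin p → ℝ} (hMM : ∀ i ∈ S, ∀ j ∈ S, |M' i j - M i j| ≤ ε)
    (hM : ∀ u : Fin p → ℝ, (∀ j, j ∉ S → u j = 0) →
      c * ∑ j, u j ^ 2 ≤ ∑ j, u j * ∑ i, u i * M i j)
    (u : Fin p → ℝ) (hu : ∀ j, j ∉ S → u j = 0) :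
    (c - k * ε) * ∑ j, u j ^ 2 ≤ ∑ j, u j * ∑ i, u i * M' i j := by
  have h1 : |∑ j, u j * ∑ i, u i * (M' i j - M i j)| ≤ (∑ i, |u i|) * ((∑ i, |u i|) * ε) := by
    rw [sum_eq_sum_support hu]
    have hle : ∑ i ∈ S, |u i| ≤ ∑ i, |u i| :=
      Finset.sum_le_sum_of_subset_of_nonneg (Finset.subset_univ S) fun _ _ _ => abs_nonneg _
    refine (abs_sum_mul_le (c := (∑ i, |u i|) * ε) fun j hj => ?_).trans ?_
    · rw [sum_eq_sum_support hu]
      exact (abs_sum_mul_le fun i hi => hMM i hi j hj).trans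
        (mul_le_mul_of_nonneg_right hle hε)
    · exact mul_le_mul_of_nonneg_right hle
        (mul_nonneg (Finset.sum_nonneg fun _ _ => abs_nonneg _) hε)
  have h2 : ∑ j, u j * ∑ i, u i * M' i j
      = ∑ j, u j * ∑ i, u i * M i j + ∑ j, u j * ∑ i, u i * (M' i j - M i j) := by
    rw [← Finset.sum_add_distrib]
    refine Finset.sum_congr rfl fun j _ => ?_
    rw [← mul_add, ← Finset.sum_add_distrib]
    congr 1
    exact Finset.sum_congr rfl fun i _ => by ring
  have h3 := sq_sum_abs_le_of_support hS hu
  have h4 := hM u hu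
  have h5 := neg_abs_le (∑ j, u j * ∑ i, u i * (M' i j - M i j))
  nlinarith

/-- Deterministic recovery: restricted convexity and irrepresentability of a symmetric matrix
`M`, closeness of the empirical second moments to `M`, and a small gradient at the truth. -/
lemma rlsRecoversSign_of_close {p : ℕ} {η : ℝ} (hη : η ≠ 0) {n : ℕ} (hn : n ≠ 0)
    {y : ℕ → Fin p → ℝ} {ξ : ℕ → ℝ} {r : Fin p} {θ₀ : Fin p → ℝ} {lam : ℝ} (hlam : 0 < lam)
    (hy : ∀ t, y (t + 1) r - y t r = η * ∑ j, θ₀ j * y t j + ξ t)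
    {S : Finset (Fin p)} (hS : ∀ j, j ∈ S ↔ θ₀ j ≠ 0) {k : ℝ} (hk : 1 ≤ k)
    (hcard : (S.card : ℝ) ≤ k) {M : Fin p → Fin p → ℝ} {α C θmin : ℝ} (hα : 0 < α) (hα1 : α ≤ 1)
    (hC : 0 < C) (hmin : ∀ j, θ₀ j ≠ 0 → θmin ≤ |θ₀ j|)
    (hM : ∀ u : Fin p → ℝ, (∀ j, j ∉ S → u j = 0) →
      C * ∑ j, u j ^ 2 ≤ ∑ j, u j * ∑ i, u i * M i j)
    (hirr : ∀ j, j ∉ S → ∃ a : Fin p → ℝ, (∀ i, i ∉ S → a i = 0) ∧ ∑ i, |a i| ≤ 1 - α ∧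
      ∀ l ∈ S, ∑ i, a i * M l i = M l j)
    (hG : ∀ j, |empGrad η n ξ y j| ≤ lam * α / 3)
    (hQ : ∀ i ∈ S, ∀ j, |empCov n y i j - M i j| ≤ α * C / (9 * k))
    (hθ : 3 / 2 * k * lam < θmin * C) :
    RlsRecoversSign η n y r lam θ₀ := by
  have hk0 : 0 < k := by linarith
  set ε := α * C / (9 * k) with hε
  have hε0 : 0 ≤ ε := by positivity
  have hkε : k * ε = α * C / 9 := by rw [hε]; field_simp
  have hm := quadForm_perturb hcard hε0 (fun i hi j _ => hQ i hi j) hM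
  set m := C - k * ε with hmdef
  have hmC : 8 / 9 * C ≤ m := by rw [hmdef, hkε]; nlinarith
  have hm0 : 0 < m := by linarith
  -- The witness is `θ₀ + d`: stationarity is solved on `S` alone, with the subgradient pinned to
  -- the sign of `θ₀`.
  obtain ⟨d, hd0, hd⟩ := exists_solution_on_support S (empCov n y) hm0 hm
    (fun j => empGrad η n ξ y j - lam * (SignType.sign (θ₀ j) : ℝ))
  set B := lam * (1 + α / 3) with hB
  have hrhs : ∀ j, |empGrad η n ξ y j - lam * (SignType.sign (θ₀ j) : ℝ)| ≤ B := by
    intro j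
    have h1 : |lam * (SignType.sign (θ₀ j) : ℝ)| ≤ lam := by
      rw [abs_mul, abs_of_pos hlam]
      have : |(SignType.sign (θ₀ j) : ℝ)| ≤ 1 := by
        rcases SignType.sign (θ₀ j) with _ | _ | _ <;> simp
      nlinarith
    have h2 := abs_sub (empGrad η n ξ y j) (lam * (SignType.sign (θ₀ j) : ℝ))
    have h3 := hG j
    rw [hB]
    nlinarith
  set l₁ := ∑ i, |d i| with hl₁
  have hl₁0 : 0 ≤ l₁ := Finset.sum_nonneg fun _ _ => abs_nonneg _
  -- Convexity gives `m ‖d‖₂² ≤ l₁ * B`, and Cauchy–Schwarz on at most `k` coordinates gives `l₁² ≤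
  -- k ‖d‖₂²`; divide by `l₁`.
  have hl₁le : m * l₁ ≤ k * B := by
    have h1 : ∑ j, d j * ∑ i, d i * empCov n y i j ≤ l₁ * B := by
      rw [sum_eq_sum_support hd0]
      refine (le_abs_self _).trans ((abs_sum_mul_le (c := B) fun j hj => ?_).trans ?_)
      · rw [hd j hj]; exact hrhs j
      · exact mul_le_mul_of_nonneg_right
          (Finset.sum_le_sum_of_subset_of_nonneg (Finset.subset_univ S)
            fun _ _ _ => abs_nonneg _) (by positivity)
    have h2 := hm d hd0
    have h3 := sq_sum_abs_le_of_support hcard hd0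
    by_cases h0 : l₁ = 0
    · rw [h0, mul_zero]; positivity
    · have hpos : 0 < l₁ := lt_of_le_of_ne hl₁0 (Ne.symm h0)
      have h4 : m * l₁ ^ 2 ≤ k * (l₁ * B) :=
        calc m * l₁ ^ 2 ≤ m * (k * ∑ i, d i ^ 2) := mul_le_mul_of_nonneg_left h3 hm0.le
          _ = k * (m * ∑ i, d i ^ 2) := by ring
          _ ≤ k * (l₁ * B) := mul_le_mul_of_nonneg_left (h2.trans h1) hk0.le
      nlinarith
  have hB0 : B ≤ 4 / 3 * lam := by rw [hB]; nlinarith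
  have hCl : C * l₁ ≤ 3 / 2 * k * lam := by
    have h1 : 8 / 9 * C * l₁ ≤ m * l₁ := mul_le_mul_of_nonneg_right hmC hl₁0
    have h2 : k * B ≤ k * (4 / 3 * lam) := mul_le_mul_of_nonneg_left hB0 hk0.le
    linarith
  have hdθ : ∀ j, |d j| < θmin := by
    intro j
    have h1 : |d j| ≤ l₁ := Finset.single_le_sum (f := fun i => |d i|)
      (fun i _ => abs_nonneg _) (Finset.mem_univ j)
    have : C * |d j| < C * θmin := by nlinarith
    exact lt_of_mul_lt_mul_left this hC.le
  have hsub : ∀ j, θ₀ j + d j - θ₀ j = d j := fun j => by ring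
  refine rlsRecoversSign_of_kkt hη hn hlam hy (fun u hu0 hu => ?_) (fun j => θ₀ j + d j)
    (fun j => ?_) (fun j hj => ?_) (fun j hj => ?_)
  · have h1 := hm u fun j hj => hu0 j (not_not.1 fun h => hj ((hS j).2 h))
    rw [quadForm_empCov] at h1
    simp only [← pow_two] at h1
    rw [hu, mul_zero] at h1
    have h3 : ∑ j, u j ^ 2 = 0 :=
      le_antisymm (by nlinarith) (Finset.sum_nonneg fun _ _ => sq_nonneg _)
    rw [Finset.sum_eq_zero_iff_of_nonneg fun _ _ => sq_nonneg _] at h3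
    funext j
    simpa using h3 j (Finset.mem_univ _)
  · by_cases hj : θ₀ j = 0
    · simp [hj, hd0 j (fun h => (hS j).1 h hj)]
    · have h1 := (hdθ j).trans_le (hmin j hj)
      rcases lt_or_gt_of_ne hj with h | h
      · rw [abs_of_neg h] at h1
        have := le_abs_self (d j)
        rw [sign_neg h, sign_neg (by linarith)]
      · rw [abs_of_pos h] at h1
        have := neg_abs_le (d j)
        rw [sign_pos h, sign_pos (by linarith)]
  · simp only [hsub]
    rw [hd j ((hS j).2 hj)]
    ring
  · simp only [hsub]
    have hjS : j ∉ S := fun h => (hS j).1 h hj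
    obtain ⟨a, ha0, ha1, ha2⟩ := hirr j hjS
    -- The population identity `∑ i, a i * M l i = M l j` expresses the off-support gradient through
    -- the one on `S`, where stationarity is known, plus two errors linear in `empCov - M`.
    have h1 : ∑ i, d i * empCov n y i j
        = ∑ i ∈ S, a i * ∑ l, d l * empCov n y l i
          - ∑ i ∈ S, a i * ∑ l ∈ S, d l * (empCov n y l i - M l i)
          + ∑ l ∈ S, d l * (empCov n y l j - M l j) := by
      have e1 : ∑ i ∈ S, a i * ∑ l, d l * empCov n y l i
          - ∑ i ∈ S, a i * ∑ l ∈ S, d l * (empCov n y l i - M l i)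
          = ∑ l ∈ S, d l * M l j := by
        rw [← Finset.sum_sub_distrib]
        calc ∑ i ∈ S, (a i * ∑ l, d l * empCov n y l i
              - a i * ∑ l ∈ S, d l * (empCov n y l i - M l i))
            = ∑ i ∈ S, ∑ l ∈ S, d l * (a i * M l i) := by
              refine Finset.sum_congr rfl fun i _ => ?_
              rw [sum_eq_sum_support hd0, ← mul_sub, ← Finset.sum_sub_distrib, Finset.mul_sum]
              exact Finset.sum_congr rfl fun l _ => by ring
          _ = ∑ l ∈ S, d l * ∑ i ∈ S, a i * M l i := by
              rw [Finset.sum_comm]; simp only [Finset.mul_sum]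
          _ = ∑ l ∈ S, d l * M l j := by
              refine Finset.sum_congr rfl fun l hl => ?_
              rw [← sum_eq_sum_support ha0, ha2 l hl]
      rw [e1, ← Finset.sum_add_distrib, sum_eq_sum_support hd0]
      exact Finset.sum_congr rfl fun l _ => by ring
    have hdS : ∑ i ∈ S, |d i| ≤ l₁ :=
      Finset.sum_le_sum_of_subset_of_nonneg (Finset.subset_univ S) fun _ _ _ => abs_nonneg _
    have haS : ∑ i ∈ S, |a i| ≤ 1 - α :=
      (Finset.sum_le_sum_of_subset_of_nonneg (Finset.subset_univ S)
        fun _ _ _ => abs_nonneg _).trans ha1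
    have b1 : |∑ i ∈ S, a i * ∑ l, d l * empCov n y l i| ≤ (1 - α) * B :=
      (abs_sum_mul_le (c := B) fun i hi => by rw [hd i hi]; exact hrhs i).trans
        (mul_le_mul_of_nonneg_right haS (by positivity))
    have b2 : |∑ i ∈ S, a i * ∑ l ∈ S, d l * (empCov n y l i - M l i)| ≤ (1 - α) * (l₁ * ε) :=
      (abs_sum_mul_le (c := l₁ * ε) fun i _ =>
        (abs_sum_mul_le (c := ε) fun l hl => hQ l hl i).trans
          (mul_le_mul_of_nonneg_right hdS hε0)).trans
        (mul_le_mul_of_nonneg_right haS (by positivity))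
    have b3 : |∑ l ∈ S, d l * (empCov n y l j - M l j)| ≤ l₁ * ε :=
      (abs_sum_mul_le (c := ε) fun l hl => hQ l hl j).trans
        (mul_le_mul_of_nonneg_right hdS hε0)
    have hlε : l₁ * ε ≤ α * lam / 6 := by
      have : l₁ * ε = α / (9 * k) * (C * l₁) := by rw [hε]; ring
      rw [this]
      calc α / (9 * k) * (C * l₁) ≤ α / (9 * k) * (3 / 2 * k * lam) :=
            mul_le_mul_of_nonneg_left hCl (by positivity)
        _ = α * lam / 6 := by field_simp; norm_num
    have hlε0 : 0 ≤ l₁ * ε := by positivity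
    have hg := hG j
    rw [h1]
    have hpos : 0 < lam * α ^ 2 := by positivity
    -- Budget: the main term is `lam (1 - 2α/3 - α²/3)`, the two perturbation errors take at most
    -- `lam α / 6` each and `empGrad` takes `lam α / 3`. The sum is at most `lam (1 - α²/3) < lam`.
    have hBe : (1 - α) * B = lam - 2 / 3 * (lam * α) - lam * α ^ 2 / 3 := by rw [hB]; ring
    have hαl : (1 - α) * (l₁ * ε) ≤ l₁ * ε := by nlinarith
    rw [abs_le] at b1 b2 b3 hg
    rw [abs_lt]
    constructor <;> linarith [b1.1, b1.2, b2.1, b2.2, b3.1, b3.2, hg.1, hg.2]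

/-! ### Stability and the Lyapunov equation -/

open Matrix in
lemma dotProduct_self_nonneg {p : ℕ} (v : Fin p → ℝ) : 0 ≤ v ⬝ᵥ v :=
  Finset.sum_nonneg fun _ _ => mul_self_nonneg _

open Matrix in
/-- The operator norm of a matrix bounds the action of its transpose. -/
lemma transpose_mulVec_dotProduct_self_le {p : ℕ} (A : Matrix (Fin p) (Fin p) ℝ)
    (u : Fin p → ℝ) :
    (Aᵀ *ᵥ u) ⬝ᵥ (Aᵀ *ᵥ u) ≤ sigmaMax A ^ 2 * (u ⬝ᵥ u) := by
  have hnorm : ∀ v : Fin p → ℝ, v ⬝ᵥ v = ‖WithLp.toLp 2 v‖ ^ 2 := by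
    intro v
    rw [EuclideanSpace.norm_sq_eq]
    simp [dotProduct, pow_two]
  have h1 : WithLp.toLp 2 (Aᵀ *ᵥ u) = toEuclideanCLM (𝕜 := ℝ) Aᵀ (WithLp.toLp 2 u) := by
    simp
  have h2 : ‖toEuclideanCLM (𝕜 := ℝ) Aᵀ‖ = sigmaMax A := by
    have : Aᵀ = star A := by simp [star_eq_conjTranspose]
    rw [this, map_star, ContinuousLinearMap.star_eq_adjoint, LinearIsometryEquiv.norm_map, sigmaMax]
  rw [hnorm, hnorm, h1, ← mul_pow, ← h2]
  exact pow_le_pow_left₀ (norm_nonneg _) (ContinuousLinearMap.le_opNorm _ _) 2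

lemma sigmaMax_nonneg {p : ℕ} (A : Matrix (Fin p) (Fin p) ℝ) : 0 ≤ sigmaMax A := norm_nonneg _

open Matrix in
/-- The adjoint dynamics: `l` steps of the transpose of `A` applied to `v`. -/
def backward {p : ℕ} (A : Matrix (Fin p) (Fin p) ℝ) (v : Fin p → ℝ) (l : ℕ) : Fin p → ℝ :=
  (Aᵀ ^ l) *ᵥ v

open Matrix in
lemma backward_zero {p : ℕ} (A : Matrix (Fin p) (Fin p) ℝ) (v : Fin p → ℝ) :
    backward A v 0 = v := by simp [backward]

open Matrix in
lemma backward_succ {p : ℕ} (A : Matrix (Fin p) (Fin p) ℝ) (v : Fin p → ℝ) (l : ℕ) :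
    backward A v (l + 1) = Aᵀ *ᵥ backward A v l := by
  simp [backward, pow_succ']

open Matrix in
lemma backward_dotProduct_mulVec {p : ℕ} (A : Matrix (Fin p) (Fin p) ℝ) (v : Fin p → ℝ) (l : ℕ)
    (x : Fin p → ℝ) : backward A v l ⬝ᵥ (A *ᵥ x) = backward A v (l + 1) ⬝ᵥ x := by
  rw [backward_succ, dotProduct_mulVec, mulVec_transpose]

open Matrix in
/-- The quantitative stability of `A` and the Lyapunov equation for its stationary covariance. -/
structure StableLyapunov {p : ℕ} (η D : ℝ) (A Q : Matrix (Fin p) (Fin p) ℝ) : Prop where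
  step_pos : 0 < η
  rate_pos : 0 < D
  rate_le : η * D ≤ 1
  sigma_le : sigmaMax A ≤ 1 - η * D
  lyapunov : A * Q * Aᵀ + η • (1 : Matrix (Fin p) (Fin p) ℝ) = Q

open Matrix in
lemma stableLyapunov_of_sparseClass {k p : ℕ} {θmin D η : ℝ} {Θ Q : Matrix (Fin p) (Fin p) ℝ}
    (hη : 0 < η) (hD : 0 < D) (hΘ : SparseClass k p θmin D η Θ) (hQ : LyapunovEq η Θ Q) :
    StableLyapunov η D (1 + η • Θ) Q := by
  have h1 := (le_div_iff₀ hη).1 hΘ.contraction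
  have h2 := sigmaMax_nonneg (1 + η • Θ)
  refine ⟨hη, hD, by linarith, by linarith, ?_⟩
  have h3 : (1 + η • Θ) * Q * (1 + η • Θ)ᵀ + η • (1 : Matrix (Fin p) (Fin p) ℝ)
      = Q + η • (Θ * Q + Q * Θᵀ + η • (Θ * Q * Θᵀ) + 1) := by
    simp only [transpose_add, transpose_one, transpose_smul, add_mul, mul_add, one_mul, mul_one,
      smul_mul_assoc, mul_smul_comm, smul_add]
    abel
  rw [h3, hQ, smul_zero, add_zero]

namespace StableLyapunov

open Matrix Filter Topology

variable {p : ℕ} {η D : ℝ} {A Q : Matrix (Fin p) (Fin p) ℝ}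

/-- The square of `sigmaMax A` would allow the rate `(1 - η D)²`; one factor is given away, since
the geometric sums remain of order `1 / (η D)`. -/
lemma backward_dotProduct_self_le (h : StableLyapunov η D A Q) (v : Fin p → ℝ) (l : ℕ) :
    backward A v l ⬝ᵥ backward A v l ≤ (1 - η * D) ^ l * (v ⬝ᵥ v) := by
  have h0 : 0 ≤ 1 - η * D := by linarith [h.rate_le]
  have hκ := mul_pos h.step_pos h.rate_pos
  induction l with
  | zero => simp [backward_zero]
  | succ l ih =>
    rw [backward_succ]
    have h2 : sigmaMax A ^ 2 ≤ 1 - η * D := by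
      nlinarith [sigmaMax_nonneg A, h.sigma_le]
    have h3 : 0 ≤ backward A v l ⬝ᵥ backward A v l := dotProduct_self_nonneg _
    calc _ ≤ sigmaMax A ^ 2 * (backward A v l ⬝ᵥ backward A v l) :=
          transpose_mulVec_dotProduct_self_le A _
      _ ≤ (1 - η * D) * ((1 - η * D) ^ l * (v ⬝ᵥ v)) :=
          mul_le_mul h2 ih h3 h0
      _ = _ := by ring

lemma tendsto_backward (h : StableLyapunov η D A Q) (v : Fin p → ℝ) :
    Tendsto (backward A v) atTop (𝓝 0) := by
  have hκ := mul_pos h.step_pos h.rate_pos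
  have h1 : Tendsto (fun l : ℕ => (1 - η * D) ^ l * (v ⬝ᵥ v)) atTop (𝓝 0) := by
    simpa using (tendsto_pow_atTop_nhds_zero_of_lt_one (by linarith [h.rate_le])
      (by linarith)).mul_const (v ⬝ᵥ v)
  rw [tendsto_pi_nhds]
  intro i
  have h2 : Tendsto (fun l => backward A v l i ^ 2) atTop (𝓝 0) := by
    refine squeeze_zero (fun _ => sq_nonneg _) (fun l => ?_) h1
    refine le_trans ?_ (h.backward_dotProduct_self_le v l)
    rw [pow_two]
    exact Finset.single_le_sum (f := fun i => backward A v l i * backward A v l i)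
      (fun i _ => mul_self_nonneg _) (Finset.mem_univ i)
  have h3 := h2.sqrt
  simp only [Real.sqrt_sq_eq_abs, Real.sqrt_zero] at h3
  exact (tendsto_zero_iff_abs_tendsto_zero _).2 h3

lemma bilin_eq (h : StableLyapunov η D A Q) (u v : Fin p → ℝ) :
    u ⬝ᵥ (Q *ᵥ v) = (Aᵀ *ᵥ u) ⬝ᵥ (Q *ᵥ (Aᵀ *ᵥ v)) + η * (u ⬝ᵥ v) := by
  conv_lhs => rw [← h.lyapunov]
  rw [add_mulVec, dotProduct_add, smul_mulVec, one_mulVec, dotProduct_smul, smul_eq_mul,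
    ← mulVec_mulVec, ← mulVec_mulVec, dotProduct_mulVec, mulVec_transpose A u]

/-- This is the series `Q = η ∑ A^l (Aᵀ)^l` with explicit remainder. Since the remainder tends to
zero, the properties of `Q` needed later follow from those of the partial sums. -/
lemma bilin_telescope (h : StableLyapunov η D A Q) (u v : Fin p → ℝ) (T : ℕ) :
    u ⬝ᵥ (Q *ᵥ v) = backward A u T ⬝ᵥ (Q *ᵥ backward A v T)
      + η * ∑ l ∈ Finset.range T, backward A u l ⬝ᵥ backward A v l := by
  induction T with
  | zero => simp [backward_zero]
  | succ T ih =>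
    rw [ih, Finset.sum_range_succ, h.bilin_eq, ← backward_succ, ← backward_succ]
    ring

lemma tendsto_bilin_backward (h : StableLyapunov η D A Q) (u v : Fin p → ℝ) :
    Tendsto (fun T => backward A u T ⬝ᵥ (Q *ᵥ backward A v T)) atTop (𝓝 0) := by
  have hc : Continuous fun z : (Fin p → ℝ) × (Fin p → ℝ) => z.1 ⬝ᵥ (Q *ᵥ z.2) := by
    unfold dotProduct mulVec dotProduct
    fun_prop
  have := (hc.tendsto (0, 0)).comp ((h.tendsto_backward u).prodMk_nhds (h.tendsto_backward v))
  simpa [Function.comp_def] using this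

/-- Symmetry of `Q` is not assumed. The partial sums are symmetric, so the antisymmetric part of the
form equals that of the remainder, which tends to zero. -/
lemma bilin_comm (h : StableLyapunov η D A Q) (u v : Fin p → ℝ) :
    u ⬝ᵥ (Q *ᵥ v) = v ⬝ᵥ (Q *ᵥ u) := by
  have h1 : ∀ T, backward A u T ⬝ᵥ (Q *ᵥ backward A v T)
      - backward A v T ⬝ᵥ (Q *ᵥ backward A u T) = u ⬝ᵥ (Q *ᵥ v) - v ⬝ᵥ (Q *ᵥ u) := by
    intro T
    rw [h.bilin_telescope u v T, h.bilin_telescope v u T]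
    simp only [dotProduct_comm (backward A v _) (backward A u _)]
    ring
  have h2 := (h.tendsto_bilin_backward u v).sub (h.tendsto_bilin_backward v u)
  simp only [h1, sub_zero] at h2
  linarith [tendsto_nhds_unique h2 tendsto_const_nhds]

lemma symm (h : StableLyapunov η D A Q) (i j : Fin p) : Q i j = Q j i := by
  simpa using h.bilin_comm (Pi.single i 1) (Pi.single j 1)

lemma quad_nonneg (h : StableLyapunov η D A Q) (v : Fin p → ℝ) : 0 ≤ v ⬝ᵥ (Q *ᵥ v) := by
  refine ge_of_tendsto' (tendsto_const_nhds.sub (h.tendsto_bilin_backward v v)) ?_ |>.trans_eq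
    (sub_zero _)
  intro T
  rw [h.bilin_telescope v v T]
  have : 0 ≤ ∑ l ∈ Finset.range T, backward A v l ⬝ᵥ backward A v l :=
    Finset.sum_nonneg fun _ _ => dotProduct_self_nonneg _
  have := mul_nonneg h.step_pos.le this
  linarith

lemma quad_le (h : StableLyapunov η D A Q) (v : Fin p → ℝ) :
    v ⬝ᵥ (Q *ᵥ v) ≤ (v ⬝ᵥ v) / D := by
  have hκ := mul_pos h.step_pos h.rate_pos
  have hη := h.step_pos
  have hD := h.rate_pos
  refine (sub_zero _).symm.trans_le
    (le_of_tendsto' (tendsto_const_nhds.sub (h.tendsto_bilin_backward v v)) ?_)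
  intro T
  rw [h.bilin_telescope v v T]
  have h1 : ∑ l ∈ Finset.range T, backward A v l ⬝ᵥ backward A v l
      ≤ (∑ l ∈ Finset.range T, (1 - η * D) ^ l) * (v ⬝ᵥ v) := by
    rw [Finset.sum_mul]
    exact Finset.sum_le_sum fun l _ => h.backward_dotProduct_self_le v l
  have h2 : ∑ l ∈ Finset.range T, (1 - η * D) ^ l ≤ 1 / (η * D) := by
    have h0 := mul_neg_geom_sum (1 - η * D) T
    have := pow_nonneg (sub_nonneg.2 h.rate_le) T
    rw [le_div_iff₀ hκ, mul_comm]
    rw [sub_sub_cancel] at h0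
    linarith
  have h3 : 0 ≤ v ⬝ᵥ v := dotProduct_self_nonneg _
  calc _ = η * ∑ l ∈ Finset.range T, backward A v l ⬝ᵥ backward A v l := by ring
    _ ≤ η * (1 / (η * D) * (v ⬝ᵥ v)) := by gcongr; exact h1.trans (by gcongr)
    _ = _ := by field_simp

end StableLyapunov

/-! ### Consequences of the assumptions on the support -/

open Matrix in
-- If `Θ r r = 0`, then `1 + η • Θ` has diagonal entry `1` at `r`, so its norm is at least `1`,
-- against contraction. Nonemptiness of the support is what allows `Cmin` to be compared with `1 /
-- D`.
lemma mem_rowSupport_self {k p : ℕ} {θmin D η : ℝ} {Θ : Matrix (Fin p) (Fin p) ℝ}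
    (hη : 0 < η) (hD : 0 < D) (hΘ : SparseClass k p θmin D η Θ) (r : Fin p) :
    r ∈ rowSupport Θ r := by
  have h1 := (le_div_iff₀ hη).1 hΘ.contraction
  have h2 := sigmaMax_nonneg (1 + η • Θ)
  have hκ := mul_pos hη hD
  simp only [rowSupport, Finset.mem_filter, Finset.mem_univ, true_and]
  intro h0
  have h3 := transpose_mulVec_dotProduct_self_le (1 + η • Θ) (Pi.single r 1)
  have h4 : ((1 + η • Θ)ᵀ *ᵥ Pi.single r 1) r = 1 := by simp [h0]
  have h5 : ((1 + η • Θ)ᵀ *ᵥ Pi.single r 1) r * ((1 + η • Θ)ᵀ *ᵥ Pi.single r 1) r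
      ≤ ((1 + η • Θ)ᵀ *ᵥ Pi.single r 1) ⬝ᵥ ((1 + η • Θ)ᵀ *ᵥ Pi.single r 1) :=
    Finset.single_le_sum (f := fun i => ((1 + η • Θ)ᵀ *ᵥ Pi.single r 1) i *
      ((1 + η • Θ)ᵀ *ᵥ Pi.single r 1) i) (fun i _ => mul_self_nonneg _) (Finset.mem_univ r)
  rw [h4] at h5
  have h6 : (Pi.single r 1 : Fin p → ℝ) ⬝ᵥ Pi.single r 1 = 1 := by simp
  rw [h6] at h3
  nlinarith

open Matrix in
/-- The smallest eigenvalue of a symmetric principal block bounds its quadratic form. -/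
lemma RestrictedConvexity.le_quadForm {p : ℕ} {Q : Matrix (Fin p) (Fin p) ℝ}
    {S : Finset (Fin p)} {C : ℝ} (h : RestrictedConvexity Q S C) (hsymm : ∀ i j, Q i j = Q j i)
    (u : Fin p → ℝ) (hu : ∀ j, j ∉ S → u j = 0) :
    C * ∑ j, u j ^ 2 ≤ ∑ j, u j * ∑ i, u i * Q i j := by
  set B := Q.toBlock (· ∈ S) (· ∈ S) with hB
  have hH : (B - C • (1 : Matrix _ _ ℝ)).IsHermitian := by
    ext i j
    simp [hB, toBlock, hsymm j i, one_apply, eq_comm]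
  have hpsd : (B - C • (1 : Matrix _ _ ℝ)).PosSemidef := by
    rw [hH.posSemidef_iff_eigenvalues_nonneg]
    intro i
    have h1 : hH.eigenvalues i ∈ spectrum ℝ (B - C • (1 : Matrix _ _ ℝ)) := by
      rw [hH.spectrum_real_eq_range_eigenvalues]
      exact ⟨i, rfl⟩
    have h2 : hH.eigenvalues i + C ∈ spectrum ℝ B := by
      have h3 : B = (B - C • (1 : Matrix _ _ ℝ)) + algebraMap ℝ _ C := by
        rw [Algebra.algebraMap_eq_smul_one]; simp
      have h4 := (spectrum.add_mem_add_iff (s := C)).2 h1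
      rwa [add_comm (algebraMap ℝ _ C), ← h3] at h4
    have := h _ h2
    simpa using this
  have h1 := hpsd.dotProduct_mulVec_nonneg fun i : {i // i ∈ S} => u i
  simp only [star_trivial, sub_mulVec, smul_mulVec, one_mulVec, dotProduct_sub, dotProduct_smul,
    smul_eq_mul] at h1
  have e1 : (fun i : {i // i ∈ S} => u i) ⬝ᵥ (fun i : {i // i ∈ S} => u i) = ∑ j, u j ^ 2 := by
    simp only [dotProduct, pow_two]
    rw [sum_eq_sum_support hu]
    exact Finset.sum_coe_sort S fun i => u i * u i
  have e2 : (fun i : {i // i ∈ S} => u i) ⬝ᵥ (B *ᵥ fun i : {i // i ∈ S} => u i)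
      = ∑ j, u j * ∑ i, u i * Q i j := by
    rw [sum_eq_sum_support hu, ← Finset.sum_coe_sort]
    simp only [dotProduct, mulVec, hB, toBlock_apply]
    refine Finset.sum_congr rfl fun j _ => ?_
    rw [sum_eq_sum_support hu, ← Finset.sum_coe_sort S fun i => u i * Q i j]
    congr 1
    exact Finset.sum_congr rfl fun i _ => by rw [hsymm, mul_comm]
  rw [e1, e2] at h1
  linarith

lemma infOpNorm_nonneg {m n : Type*} [Fintype n] (M : Matrix m n ℝ) : 0 ≤ infOpNorm M :=
  Real.iSup_nonneg fun _ => Finset.sum_nonneg fun _ _ => abs_nonneg _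

open Matrix in
-- The coefficients form row `j` of `Q_{Sᶜ,S} (Q_{S,S})⁻¹`. Convexity keeps `0` out of the spectrum
-- of the block, so `⁻¹` is a genuine inverse.
lemma Irrepresentability.exists_coeff {p : ℕ} {Q : Matrix (Fin p) (Fin p) ℝ}
    {S : Finset (Fin p)} {C α : ℝ} (h : Irrepresentability Q S α) (hC : 0 < C)
    (hconv : RestrictedConvexity Q S C) (hsymm : ∀ i j, Q i j = Q j i) (j : Fin p) (hj : j ∉ S) :
    ∃ a : Fin p → ℝ, (∀ i, i ∉ S → a i = 0) ∧ ∑ i, |a i| ≤ 1 - α ∧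
      ∀ l ∈ S, ∑ i, a i * Q l i = Q l j := by
  classical
  set B := Q.toBlock (· ∈ S) (· ∈ S) with hB
  set E := Q.toBlock (· ∉ S) (· ∈ S) with hE
  have hunit : IsUnit B := by
    rw [← spectrum.zero_notMem_iff ℝ]
    intro h0
    linarith [hconv 0 h0]
  have hdet : IsUnit B.det := (isUnit_iff_isUnit_det B).1 hunit
  let a : Fin p → ℝ := fun i => if hi : i ∈ S then (E * B⁻¹) ⟨j, hj⟩ ⟨i, hi⟩ else 0
  have ha0 : ∀ i, i ∉ S → a i = 0 := fun i hi => by simp [a, hi]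
  have ha1 : ∀ i : {i // i ∈ S}, a i = (E * B⁻¹) ⟨j, hj⟩ i := fun i => by simp [a]
  refine ⟨a, ha0, ?_, fun l hl => ?_⟩
  · have e1 : ∑ i, |a i| = ∑ i : {i // i ∈ S}, |(E * B⁻¹) ⟨j, hj⟩ i| := by
      rw [← Finset.sum_subset (Finset.subset_univ S)
        (fun i _ hi => by rw [ha0 i hi, abs_zero]), ← Finset.sum_coe_sort]
      exact Finset.sum_congr rfl fun i _ => by rw [ha1]
    rw [e1]
    refine le_trans ?_ h
    exact le_ciSup (f := fun i => ∑ l, |(E * B⁻¹) i l|) (Set.finite_range _).bddAbove ⟨j, hj⟩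
  · have e1 : (E * B⁻¹ * B) ⟨j, hj⟩ ⟨l, hl⟩ = E ⟨j, hj⟩ ⟨l, hl⟩ := by
      rw [Matrix.mul_assoc, nonsing_inv_mul B hdet, Matrix.mul_one]
    rw [mul_apply] at e1
    rw [sum_eq_sum_support ha0, ← Finset.sum_coe_sort]
    simp only [hE, toBlock_apply] at e1
    rw [hsymm l j, ← e1]
    refine Finset.sum_congr rfl fun i _ => ?_
    rw [ha1, hB, toBlock_apply, hsymm l i]

/-! ### Gaussian exponential moments and independence -/

/-- Completing the square: the tilted density is a constant times a Gaussian density of variance `ν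
/ (1 - 2cν)`, and the constant is the exponential moment. -/
lemma gaussianPDFReal_mul_exp_sq {ν : NNReal} (hν : ν ≠ 0) {c m : ℝ} (hc : 2 * c * ν < 1)
    (x : ℝ) :
    gaussianPDFReal 0 ν x * Real.exp (c * (m + x) ^ 2)
      = Real.exp (-Real.log (1 - 2 * c * ν) / 2 + c * m ^ 2 / (1 - 2 * c * ν))
        * gaussianPDFReal (2 * c * m * ν / (1 - 2 * c * ν)) (ν / (1 - 2 * c * ν).toNNReal) x := by
  have hν0 : (0 : ℝ) < ν := by exact_mod_cast pos_iff_ne_zero.2 hν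
  have hd : 0 < 1 - 2 * c * ν := by linarith
  have hd' : 1 - 2 * c * (ν : ℝ) ≠ 0 := hd.ne'
  have h1 : ((ν / (1 - 2 * c * ν).toNNReal : NNReal) : ℝ) = ν / (1 - 2 * c * ν) := by
    rw [NNReal.coe_div, Real.coe_toNNReal _ hd.le]
  have h2 : Real.exp (-Real.log (1 - 2 * c * ν) / 2) = (√(1 - 2 * c * ν))⁻¹ := by
    rw [neg_div, Real.exp_neg, Real.sqrt_eq_rpow, Real.rpow_def_of_pos hd]
    congr 2
    ring
  simp only [gaussianPDFReal_def]
  rw [h1, Real.exp_add, h2, ← mul_div_assoc, Real.sqrt_div (by positivity), inv_div, mul_assoc,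
    ← Real.exp_add]
  have h3 : √(1 - 2 * c * ν) ≠ 0 := (Real.sqrt_pos.2 hd).ne'
  have h4 : ∀ a b z : ℝ, (√(1 - 2 * c * ν))⁻¹ * a * (√(1 - 2 * c * ν) / z * b)
      = z⁻¹ * (a * b) := fun a b z => by field_simp
  rw [h4, ← Real.exp_add]
  congr 2
  clear h1 h2 h3 h4 hd
  generalize hdef : 1 - 2 * c * (ν : ℝ) = d at hd' ⊢
  have hcd : c = (1 - d) / (2 * ν) := by field_simp; linarith
  rw [hcd]
  field_simp
  ring

section Gaussian

variable {Ω : Type*} [MeasurableSpace Ω] {P : Measure Ω}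

/-- The exponential moment of the square of a shifted centred Gaussian variable. -/
lemma lintegral_exp_sq_gaussian {X : Ω → ℝ} {ν : NNReal}
    (hX : HasLaw X (gaussianReal 0 ν) P) (hν : ν ≠ 0) {c : ℝ} (m : ℝ) (hc : 2 * c * ν < 1) :
    ∫⁻ ω, ENNReal.ofReal (Real.exp (c * (m + X ω) ^ 2)) ∂P
      = ENNReal.ofReal
          (Real.exp (-Real.log (1 - 2 * c * ν) / 2 + c * m ^ 2 / (1 - 2 * c * ν))) := by
  have hd : 0 < 1 - 2 * c * ν := by linarith
  have hmeas : Measurable fun x : ℝ => ENNReal.ofReal (Real.exp (c * (m + x) ^ 2)) := by fun_prop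
  rw [← lintegral_map' (f := fun x : ℝ => ENNReal.ofReal (Real.exp (c * (m + x) ^ 2)))
    hmeas.aemeasurable hX.aemeasurable, hX.map_eq, gaussianReal_of_var_ne_zero 0 hν,
    lintegral_withDensity_eq_lintegral_mul _ (measurable_gaussianPDF 0 ν) hmeas]
  have hν' : ν / (1 - 2 * c * ν).toNNReal ≠ 0 :=
    div_ne_zero hν (by simpa using hd)
  rw [← mul_one (ENNReal.ofReal (Real.exp (-_ / 2 + _))),
    ← lintegral_gaussianPDF_eq_one (2 * c * m * ν / (1 - 2 * c * ν)) hν',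
    ← lintegral_const_mul _ (measurable_gaussianPDF _ _)]
  refine lintegral_congr fun x => ?_
  simp only [Pi.mul_apply, gaussianPDF]
  rw [← ENNReal.ofReal_mul (gaussianPDFReal_nonneg _ _ _), gaussianPDFReal_mul_exp_sq hν hc,
    ENNReal.ofReal_mul (Real.exp_pos _).le]

lemma prod_ofReal_exp_rpow {ι : Type*} (s : Finset ι) (z q : ι → ℝ) :
    ∏ i ∈ s, ENNReal.ofReal (Real.exp (z i)) ^ q i
      = ENNReal.ofReal (Real.exp (∑ i ∈ s, z i * q i)) := by
  rw [Real.exp_sum, ENNReal.ofReal_prod_of_nonneg fun _ _ => (Real.exp_pos _).le]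
  refine Finset.prod_congr rfl fun i _ => ?_
  rw [ENNReal.ofReal_rpow_of_pos (Real.exp_pos _), Real.exp_mul]

/-- The exponential moment of a weighted sum of squares of shifted, arbitrarily dependent, centred
Gaussian variables is at most that of a single one with the total variance. -/
lemma lintegral_exp_sum_sq_gaussian_le [IsProbabilityMeasure P] {ι : Type*} (s : Finset ι)
    {X : ι → Ω → ℝ} {ν : ι → NNReal} (hX : ∀ i, HasLaw (X i) (gaussianReal 0 (ν i)) P)
    {c : ι → ℝ} (hc : ∀ i, 0 ≤ c i) {m : ι → ℝ} (hm : ∀ i, ν i = 0 → m i = 0) {a : ℝ}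
    (ha : 2 * a * ∑ i ∈ s, c i * ν i < 1) :
    ∫⁻ ω, ENNReal.ofReal (Real.exp (a * ∑ i ∈ s, c i * (m i + X i ω) ^ 2)) ∂P
      ≤ ENNReal.ofReal (Real.exp (-Real.log (1 - 2 * a * ∑ i ∈ s, c i * ν i) / 2
          + a * (∑ i ∈ s, c i * m i ^ 2) / (1 - 2 * a * ∑ i ∈ s, c i * ν i))) := by
  set τ := ∑ i ∈ s, c i * (ν i : ℝ) with hτ
  have hterm : ∀ i ∈ s, 0 ≤ c i * (ν i : ℝ) := fun i _ => mul_nonneg (hc i) (ν i).2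
  have hnull : ∀ i, ν i = 0 → ∀ᵐ ω ∂P, X i ω = 0 := by
    intro i hi
    have h1 := hX i
    rw [hi, gaussianReal_zero_var] at h1
    have h2 : ∀ᵐ z ∂(P.map (X i)), z = 0 := by
      rw [h1.map_eq]
      exact (ae_dirac_iff (measurableSet_singleton 0)).2 rfl
    exact ae_of_ae_map h1.aemeasurable h2
  -- If the total variance vanishes, every summand is almost surely zero and both sides equal `1`;
  -- otherwise `τ` may serve as a denominator.
  rcases (Finset.sum_nonneg hterm).eq_or_lt with h0 | hpos
  · have h1 := (Finset.sum_eq_zero_iff_of_nonneg hterm).1 h0.symm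
    have h2 : ∀ᵐ ω ∂P, ∀ i ∈ s, c i * (m i + X i ω) ^ 2 = 0 := by
      refine (Filter.eventually_all_finset s).2 fun i hi => ?_
      rcases mul_eq_zero.1 (h1 i hi) with h | h
      · simp [h]
      · have h3 : ν i = 0 := by exact_mod_cast h
        filter_upwards [hnull i h3] with ω hω
        simp [hω, hm i h3]
    have h3 : ∑ i ∈ s, c i * m i ^ 2 = 0 := by
      refine Finset.sum_eq_zero fun i hi => ?_
      rcases mul_eq_zero.1 (h1 i hi) with h | h
      · simp [h]
      · rw [hm i (by exact_mod_cast h)]; simp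
    have h4 : ∫⁻ ω, ENNReal.ofReal (Real.exp (a * ∑ i ∈ s, c i * (m i + X i ω) ^ 2)) ∂P
        = ∫⁻ _, 1 ∂P := by
      refine lintegral_congr_ae ?_
      filter_upwards [h2] with ω hω
      rw [Finset.sum_eq_zero hω]
      simp
    have h5 : τ = 0 := h0.symm
    rw [h4, h3, h5]
    simp
  · have hτ0 : τ ≠ 0 := hpos.ne'
    have hae : ∀ᵐ ω ∂P, ∀ i ∈ s, ν i = 0 → X i ω = 0 := by
      refine (Filter.eventually_all_finset s).2 fun i _ => ?_
      by_cases hi : ν i = 0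
      · filter_upwards [hnull i hi] with ω hω _ using hω
      · exact Filter.Eventually.of_forall fun ω h => absurd h hi
    -- Hölder with exponents `c i * ν i / τ`, which sum to `1`. They are chosen so that each factor
    -- has coefficient times variance equal to `a * τ`; hence all factors carry the same logarithm
    -- and dependence does no harm.
    have h1 : ∫⁻ ω, ENNReal.ofReal (Real.exp (a * ∑ i ∈ s, c i * (m i + X i ω) ^ 2)) ∂P
        = ∫⁻ ω, ∏ i ∈ s, ENNReal.ofReal (Real.exp (a * τ / ν i * (m i + X i ω) ^ 2))
            ^ (c i * ν i / τ) ∂P := by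
      refine lintegral_congr_ae ?_
      filter_upwards [hae] with ω hω
      rw [prod_ofReal_exp_rpow, Finset.mul_sum]
      congr 2
      refine Finset.sum_congr rfl fun i hi => ?_
      by_cases h : ν i = 0
      · simp [hω i hi h, hm i h]
      · have : (ν i : ℝ) ≠ 0 := by exact_mod_cast h
        field_simp
    have h2 : ∏ i ∈ s, (∫⁻ ω, ENNReal.ofReal (Real.exp (a * τ / ν i * (m i + X i ω) ^ 2)) ∂P)
          ^ (c i * ν i / τ)
        = ∏ i ∈ s, ENNReal.ofReal (Real.exp (-Real.log (1 - 2 * a * τ) / 2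
            + a * τ / ν i * m i ^ 2 / (1 - 2 * a * τ))) ^ (c i * ν i / τ) := by
      refine Finset.prod_congr rfl fun i _ => ?_
      by_cases h : ν i = 0
      · simp [h]
      · have hν : (ν i : ℝ) ≠ 0 := by exact_mod_cast h
        have h3 : 2 * (a * τ / ν i) * ν i = 2 * a * τ := by field_simp
        rw [lintegral_exp_sq_gaussian (hX i) h (m i) (by rw [h3]; exact ha), h3]
    rw [h1]
    refine (ENNReal.lintegral_prod_norm_pow_le s (fun i _ => ?_) ?_ fun i hi => ?_).trans ?_
    · have := (hX i).aemeasurable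
      fun_prop
    · rw [← Finset.sum_div, div_self hτ0]
    · exact div_nonneg (hterm i hi) hpos.le
    · rw [h2, prod_ofReal_exp_rpow]
      refine le_of_eq ?_
      congr 2
      simp only [add_mul, Finset.sum_add_distrib]
      congr 1
      · rw [← Finset.mul_sum, ← Finset.sum_div, div_self hτ0, mul_one]
      · clear_value τ
        rw [Finset.mul_sum, Finset.sum_div]
        refine Finset.sum_congr rfl fun i _ => ?_
        by_cases h : ν i = 0
        · simp [h, hm i h]
        · have hν : (ν i : ℝ) ≠ 0 := by exact_mod_cast h
          have hd : 1 - 2 * a * τ ≠ 0 := by linarith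
          field_simp

/-- Integration over an independent pair. -/
lemma lintegral_indepFun [IsProbabilityMeasure P] {E F : Type*} [MeasurableSpace E]
    [MeasurableSpace F] {Z : Ω → E} {W : Ω → F} (hZ : Measurable Z) (hW : Measurable W)
    (h : IndepFun Z W P) {G : E → F → ENNReal} (hG : Measurable (Function.uncurry G)) :
    ∫⁻ ω, G (Z ω) (W ω) ∂P = ∫⁻ ω, ∫⁻ ω', G (Z ω) (W ω') ∂P ∂P := by
  have h1 := (indepFun_iff_map_prod_eq_prod_map_map hZ.aemeasurable hW.aemeasurable).1 h
  have : IsProbabilityMeasure (P.map W) := Measure.isProbabilityMeasure_map hW.aemeasurable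
  calc ∫⁻ ω, G (Z ω) (W ω) ∂P
      = ∫⁻ z, Function.uncurry G z ∂(P.map fun ω => (Z ω, W ω)) :=
        (lintegral_map hG (hZ.prodMk hW)).symm
    _ = ∫⁻ z, ∫⁻ w, G z w ∂(P.map W) ∂(P.map Z) := by
        rw [h1, lintegral_prod _ hG.aemeasurable]; rfl
    _ = ∫⁻ ω, ∫⁻ w, G (Z ω) w ∂(P.map W) ∂P :=
        lintegral_map (f := fun z => ∫⁻ w, G z w ∂(P.map W)) hG.lintegral_prod_right' hZ
    _ = _ := by
        refine lintegral_congr fun ω => ?_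
        exact lintegral_map (hG.comp measurable_prodMk_left) hW

/-- If `X` is independent of the pair `(Y, Z)` and `Y` of `Z`, then `(X, Y)` is independent
of `Z`. -/
lemma indepFun_prodMk_of_indepFun [IsProbabilityMeasure P] {E F G : Type*} [MeasurableSpace E]
    [MeasurableSpace F] [MeasurableSpace G] {X : Ω → E} {Y : Ω → F} {Z : Ω → G}
    (hX : Measurable X) (hY : Measurable Y) (hZ : Measurable Z)
    (h : IndepFun X (fun ω => (Y ω, Z ω)) P) (hYZ : IndepFun Y Z P) :
    IndepFun (fun ω => (X ω, Y ω)) Z P := by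
  have hXY : IndepFun X Y P := h.comp measurable_id measurable_fst
  rw [indepFun_iff_map_prod_eq_prod_map_map hX.aemeasurable (hY.prodMk hZ).aemeasurable] at h
  rw [indepFun_iff_map_prod_eq_prod_map_map hY.aemeasurable hZ.aemeasurable] at hYZ
  rw [indepFun_iff_map_prod_eq_prod_map_map hX.aemeasurable hY.aemeasurable] at hXY
  rw [indepFun_iff_map_prod_eq_prod_map_map (hX.prodMk hY).aemeasurable hZ.aemeasurable, hXY]
  have := Measure.isProbabilityMeasure_map (μ := P) hX.aemeasurable
  have := Measure.isProbabilityMeasure_map (μ := P) hY.aemeasurable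
  have := Measure.isProbabilityMeasure_map (μ := P) hZ.aemeasurable
  have e1 : P.map (fun ω => ((X ω, Y ω), Z ω))
      = (P.map fun ω => (X ω, (Y ω, Z ω))).map MeasurableEquiv.prodAssoc.symm := by
    rw [Measure.map_map MeasurableEquiv.prodAssoc.symm.measurable (hX.prodMk (hY.prodMk hZ))]
    rfl
  rw [e1, h, hYZ, ← Measure.prodAssoc_prod,
    Measure.map_map MeasurableEquiv.prodAssoc.symm.measurable MeasurableEquiv.prodAssoc.measurable,
    MeasurableEquiv.symm_comp_self, Measure.map_id]

end Gaussian

/-! ### Independence of past and noise, and the stationary law -/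

namespace StationaryTrajectory

open Matrix

variable {p : ℕ} {Ω : Type*} [MeasurableSpace Ω] {P : Measure Ω}
  {η : ℝ} {Θ : Matrix (Fin p) (Fin p) ℝ} {x w : ℕ → Ω → Fin p → ℝ}

lemma step_eq (h : StationaryTrajectory P η Θ x w) (t : ℕ) (ω : Ω) :
    x (t + 1) ω = (1 + η • Θ) *ᵥ x t ω + w (t + 1) ω := by
  rw [h.step, add_mulVec, one_mulVec, smul_mulVec]

lemma measurable_apply (h : StationaryTrajectory P η Θ x w) (t : ℕ) : Measurable (x t) := by
  induction t with
  | zero => exact h.meas_init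
  | succ t ih =>
    have : x (t + 1) = fun ω => x t ω + η • Θ.mulVec (x t ω) + w (t + 1) ω :=
      funext fun ω => h.step t ω
    rw [this]
    have h1 : Measurable fun ω => Θ.mulVec (x t ω) :=
      (Continuous.matrix_mulVec continuous_const continuous_id).measurable.comp ih
    exact (ih.add (h1.const_smul η)).add (h.meas_noise t)

variable [IsProbabilityMeasure P]

/-- The path up to time `t` is independent of the next noise vector. -/
lemma indepFun_past (h : StationaryTrajectory P η Θ x w) (t : ℕ) :
    IndepFun (fun ω (s : ℕ) => x (min s t) ω) (w (t + 1)) P := by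
  classical
  let S : Finset (ℕ × Fin p) := Finset.range t ×ˢ Finset.univ
  let T : Finset (ℕ × Fin p) := {t} ×ˢ Finset.univ
  have hST : Disjoint S T := by
    rw [Finset.disjoint_left]
    rintro ⟨a, i⟩ ha hb
    simp only [S, T, Finset.mem_product, Finset.mem_range, Finset.mem_singleton,
      Finset.mem_univ, and_true] at ha hb
    omega
  -- Noise up to time `t`, padded by zero. The path stopped at `t` is a measurable function of `x 0`
  -- and `past`, and this pair is independent of `w (t + 1)`.
  let past : Ω → ℕ → Fin p → ℝ := fun ω s => if s < t then w (s + 1) ω else 0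
  have hpast : Measurable past := by
    refine measurable_pi_lambda _ fun s => ?_
    by_cases hs : s < t
    · simpa [past, hs] using h.meas_noise s
    · simp [past, hs]
  have h1 : IndepFun past (w (t + 1)) P := by
    have h0 := h.noise_indep.indepFun_finset S T hST
      fun a => (measurable_pi_apply a.2).comp (h.meas_noise a.1)
    let φ : (S → ℝ) → ℕ → Fin p → ℝ :=
      fun f s i => if hs : (s, i) ∈ S then f ⟨(s, i), hs⟩ else 0
    let ψ : (T → ℝ) → Fin p → ℝ := fun f i => f ⟨(t, i), by simp [T]⟩
    have hφ : Measurable φ := by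
      refine measurable_pi_lambda _ fun s => measurable_pi_lambda _ fun i => ?_
      by_cases hs : (s, i) ∈ S
      · simpa [φ, hs] using measurable_pi_apply _
      · simp [φ, hs]
    have hψ : Measurable ψ := measurable_pi_lambda _ fun i => measurable_pi_apply _
    have h2 := h0.comp hφ hψ
    have h3 : past = φ ∘ fun ω (a : S) => w (a.1.1 + 1) ω a.1.2 := by
      funext ω s i
      by_cases hs : s < t <;> simp [past, φ, S, hs]
    rw [h3]
    exact h2
  have h2 : IndepFun (x 0) (fun ω => (past ω, w (t + 1) ω)) P := by
    let φ : (ℕ → Fin p → ℝ) → (ℕ → Fin p → ℝ) × (Fin p → ℝ) :=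
      fun f => (fun s => if s < t then f s else 0, f t)
    have hφ : Measurable φ := by
      refine Measurable.prodMk (measurable_pi_lambda _ fun s => ?_) (measurable_pi_apply t)
      by_cases hs : s < t
      · simpa [hs] using measurable_pi_apply s
      · simp [hs]
    exact h.init_indep.comp measurable_id hφ
  have h3 := indepFun_prodMk_of_indepFun h.meas_init hpast (h.meas_noise t) h2 h1
  let Φ : (Fin p → ℝ) × (ℕ → Fin p → ℝ) → ℕ → Fin p → ℝ := fun z s =>
    Nat.rec z.1 (fun s y => y + η • Θ.mulVec y + z.2 s) s
  have hΦ : ∀ s, Measurable fun z => Φ z s := by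
    intro s
    induction s with
    | zero => exact measurable_fst
    | succ s ih =>
      have h4 : Measurable fun z => Θ.mulVec (Φ z s) :=
        (Continuous.matrix_mulVec continuous_const continuous_id).measurable.comp ih
      exact (ih.add (h4.const_smul η)).add ((measurable_pi_apply s).comp measurable_snd)
  have hx : ∀ ω s, s ≤ t → x s ω = Φ (x 0 ω, past ω) s := by
    intro ω s
    induction s with
    | zero => intro _; rfl
    | succ s ih =>
      intro hs
      rw [h.step, ih (by omega)]
      have : past ω s = w (s + 1) ω := by simp [past, show s < t by omega]
      rw [← this]
  have h4 := h3.comp (φ := fun z s => Φ z (min s t)) (ψ := id)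
    (measurable_pi_lambda _ fun s => hΦ _) measurable_id
  have h5 : (fun ω (s : ℕ) => x (min s t) ω)
      = (fun z s => Φ z (min s t)) ∘ fun ω => (x 0 ω, past ω) :=
    funext fun ω => funext fun s => hx ω _ (min_le_right _ _)
  rw [h5]
  exact h4

/-- Conditioning on the path up to time `t`. -/
lemma lintegral_step (h : StationaryTrajectory P η Θ x w) (t : ℕ)
    {G : (ℕ → Fin p → ℝ) → (Fin p → ℝ) → ENNReal} (hG : Measurable (Function.uncurry G)) :
    ∫⁻ ω, G (fun s => x (min s t) ω) (w (t + 1) ω) ∂P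
      = ∫⁻ ω, ∫⁻ ω', G (fun s => x (min s t) ω) (w (t + 1) ω') ∂P ∂P :=
  lintegral_indepFun (measurable_pi_lambda _ fun _ => h.measurable_apply _) (h.meas_noise t)
    (h.indepFun_past t) hG

lemma hasLaw_noise (h : StationaryTrajectory P η Θ x w) (hη : 0 < η) (t : ℕ) (u : Fin p → ℝ) :
    HasLaw (fun ω => u ⬝ᵥ w (t + 1) ω) (gaussianReal 0 (η * (u ⬝ᵥ u)).toNNReal) P := by
  have hmw : ∀ i, Measurable fun ω => w (t + 1) ω i :=
    fun i => (measurable_pi_apply i).comp (h.meas_noise t)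
  have hm : Measurable fun ω => u ⬝ᵥ w (t + 1) ω :=
    Finset.measurable_sum _ fun i _ => (hmw i).const_mul (u i)
  refine ⟨hm.aemeasurable, ?_⟩
  have := Measure.isProbabilityMeasure_map (μ := P) hm.aemeasurable
  refine Measure.ext_of_charFun (funext fun a => ?_)
  have hind : iIndepFun (fun i ω => u i * w (t + 1) ω i) P := by
    have h1 := h.noise_indep.precomp (g := fun i : Fin p => (t, i))
      (fun i j hij => (Prod.mk.inj hij).2)
    exact h1.comp (fun i z => u i * z) fun i => measurable_const_mul (u i)
  have h1 := hind.charFun_map_fun_sum_eq_prod fun i => ((hmw i).const_mul (u i)).aemeasurable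
  have h2 : (fun ω => u ⬝ᵥ w (t + 1) ω) = fun ω => ∑ i, u i * w (t + 1) ω i := rfl
  rw [h2, h1, Finset.prod_apply]
  have h3 : ∀ i, charFun (P.map fun ω => u i * w (t + 1) ω i) a
      = Complex.exp (-(η * (u i * a) ^ 2 / 2)) := by
    intro i
    have h4 : (P.map fun ω => u i * w (t + 1) ω i)
        = (P.map fun ω => w (t + 1) ω i).map fun z => u i * z := by
      rw [Measure.map_map (measurable_const_mul _) (hmw i)]; rfl
    rw [h4, charFun_map_mul, (h.noise_law t i).map_eq, charFun_gaussianReal,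
      Real.coe_toNNReal _ hη.le]
    congr 1
    push_cast
    ring
  simp only [h3]
  have h5 : (0 : ℝ) ≤ η * (u ⬝ᵥ u) := mul_nonneg hη.le (dotProduct_self_nonneg u)
  rw [← Complex.exp_sum, charFun_gaussianReal, Real.coe_toNNReal _ h5]
  congr 1
  simp only [dotProduct]
  push_cast
  rw [Finset.sum_neg_distrib, ← Finset.sum_div, mul_zero, zero_mul, zero_sub, Finset.mul_sum,
    Finset.sum_mul]
  congr 2
  exact Finset.sum_congr rfl fun i _ => by ring

variable {D : ℝ} {Q : Matrix (Fin p) (Fin p) ℝ}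

/-- Since `x 1` has the law of `x 0`, one step of the dynamics is a functional equation for the
characteristic function `φ` of `x 0`: `φ(u) = φ(Aᵀ u) exp(-η |u|² / 2)`. -/
lemma charFun_init_step (h : StationaryTrajectory P η Θ x w) (hη : 0 < η) (u : Fin p → ℝ) :
    charFun (P.map fun ω => u ⬝ᵥ x 0 ω) 1
      = charFun (P.map fun ω => ((1 + η • Θ)ᵀ *ᵥ u) ⬝ᵥ x 0 ω) 1
        * Complex.exp (-(η * (u ⬝ᵥ u) / 2 : ℝ)) := by
  have hdot : ∀ v : Fin p → ℝ, Measurable fun z : Fin p → ℝ => v ⬝ᵥ z := fun v => by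
    unfold dotProduct
    fun_prop
  have h1 : P.map (fun ω => u ⬝ᵥ x 0 ω) = P.map (fun ω => u ⬝ᵥ x 1 ω) :=
    ((h.stationary 1).comp (hdot u)).map_eq.symm
  have h2 : (fun ω => u ⬝ᵥ x 1 ω)
      = (fun ω => ((1 + η • Θ)ᵀ *ᵥ u) ⬝ᵥ x 0 ω) + fun ω => u ⬝ᵥ w (0 + 1) ω := by
    funext ω
    rw [← zero_add 1, h.step_eq, dotProduct_add, dotProduct_mulVec, mulVec_transpose]
    rfl
  have h3 : IndepFun (x 0) (w (0 + 1)) P :=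
    h.init_indep.comp measurable_id (measurable_pi_apply 0)
  have h4 := (h3.comp (hdot ((1 + η • Θ)ᵀ *ᵥ u)) (hdot u)).charFun_map_add_eq_mul
    ((hdot _).comp h.meas_init).aemeasurable ((hdot _).comp (h.meas_noise 0)).aemeasurable
  rw [h1, h2]
  refine (congrFun h4 1).trans ?_
  rw [Pi.mul_apply]
  congr 1
  have h5 := (h.hasLaw_noise hη 0 u).map_eq
  have h6 : (0 : ℝ) ≤ η * (u ⬝ᵥ u) := mul_nonneg hη.le (dotProduct_self_nonneg u)
  change charFun (P.map fun ω => u ⬝ᵥ w (0 + 1) ω) 1 = _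
  rw [h5, charFun_gaussianReal, Real.coe_toNNReal _ h6]
  congr 1
  push_cast
  ring

open Filter Topology in
-- Iterating the functional equation sends the argument to zero, where the characteristic function
-- tends to `1` by dominated convergence; the accumulated Gaussian factors telescope to the form of
-- `Q`. Gaussianity of the initial state is thus a consequence of stationarity.
lemma hasLaw_init (h : StationaryTrajectory P η Θ x w)
    (hs : StableLyapunov η D (1 + η • Θ) Q) (u : Fin p → ℝ) :
    HasLaw (fun ω => u ⬝ᵥ x 0 ω) (gaussianReal 0 (u ⬝ᵥ (Q *ᵥ u)).toNNReal) P := by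
  have hdot : ∀ v : Fin p → ℝ, Measurable fun ω => v ⬝ᵥ x 0 ω := fun v =>
    Finset.measurable_sum _ fun i _ =>
      ((measurable_pi_apply i).comp h.meas_init).const_mul (v i)
  have hiter : ∀ (v : Fin p → ℝ) (T : ℕ), charFun (P.map fun ω => v ⬝ᵥ x 0 ω) 1
      = charFun (P.map fun ω => backward (1 + η • Θ) v T ⬝ᵥ x 0 ω) 1
        * Complex.exp (-((v ⬝ᵥ (Q *ᵥ v) - backward (1 + η • Θ) v T ⬝ᵥ
            (Q *ᵥ backward (1 + η • Θ) v T)) / 2 : ℝ)) := by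
    intro v T
    induction T with
    | zero => simp [backward_zero]
    | succ T ih =>
      rw [ih, h.charFun_init_step hs.step_pos, ← backward_succ, mul_assoc, ← Complex.exp_add,
        hs.bilin_eq (backward (1 + η • Θ) v T), ← backward_succ]
      congr 2
      push_cast
      ring
  have hlim : ∀ v : Fin p → ℝ,
      Tendsto (fun T => charFun (P.map fun ω => backward (1 + η • Θ) v T ⬝ᵥ x 0 ω) 1)
        atTop (𝓝 1) := by
    intro v
    have e1 : ∀ T, charFun (P.map fun ω => backward (1 + η • Θ) v T ⬝ᵥ x 0 ω) 1
        = ∫ ω, Complex.exp ((backward (1 + η • Θ) v T ⬝ᵥ x 0 ω : ℝ) * Complex.I) ∂P := by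
      intro T
      rw [charFun_apply_real, integral_map (hdot _).aemeasurable (by fun_prop)]
      simp
    simp only [e1]
    have e2 : (1 : ℂ) = ∫ _, 1 ∂P := by simp
    rw [e2]
    refine tendsto_integral_of_dominated_convergence (fun _ => 1) (fun T => ?_)
      (integrable_const _) (fun T => ?_) ?_
    · exact (Complex.measurable_exp.comp ((Complex.measurable_ofReal.comp
        (hdot (backward (1 + η • Θ) v T))).mul_const _)).aestronglyMeasurable
    · exact Filter.Eventually.of_forall fun ω => by rw [Complex.norm_exp_ofReal_mul_I]
    · refine Filter.Eventually.of_forall fun ω => ?_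
      have hc : Continuous fun z : Fin p → ℝ =>
          Complex.exp ((z ⬝ᵥ x 0 ω : ℝ) * Complex.I) := by
        unfold dotProduct
        fun_prop
      simpa [Function.comp_def] using (hc.tendsto 0).comp (hs.tendsto_backward v)
  have hφ : ∀ v : Fin p → ℝ, charFun (P.map fun ω => v ⬝ᵥ x 0 ω) 1
      = Complex.exp (-(v ⬝ᵥ (Q *ᵥ v) / 2 : ℝ)) := by
    intro v
    have h1 := (hs.tendsto_bilin_backward v v)
    have hc : Continuous fun z : ℝ => Complex.exp (-((v ⬝ᵥ (Q *ᵥ v) - z) / 2 : ℝ)) := by fun_prop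
    have h2 := (hlim v).mul ((hc.tendsto 0).comp h1)
    simp only [Function.comp_def, ← hiter v] at h2
    have h3 := tendsto_nhds_unique tendsto_const_nhds h2
    rw [h3]
    simp
  refine ⟨(hdot u).aemeasurable, ?_⟩
  have := Measure.isProbabilityMeasure_map (μ := P) (hdot u).aemeasurable
  refine Measure.ext_of_charFun (funext fun a => ?_)
  have h1 : charFun (P.map fun ω => u ⬝ᵥ x 0 ω) a
      = charFun (P.map fun ω => (a • u) ⬝ᵥ x 0 ω) 1 := by
    have h2 : (P.map fun ω => (a • u) ⬝ᵥ x 0 ω)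
        = (P.map fun ω => u ⬝ᵥ x 0 ω).map fun z => a * z := by
      rw [Measure.map_map (measurable_const_mul _) (hdot u)]
      simp [Function.comp_def]
    rw [h2, charFun_map_mul, mul_one]
  rw [h1, hφ, charFun_gaussianReal, Real.coe_toNNReal _ (hs.quad_nonneg u), mulVec_smul,
    dotProduct_smul, smul_dotProduct]
  congr 1
  simp only [smul_eq_mul]
  push_cast
  ring

end StationaryTrajectory

/-! ### The discounted energy and its trace -/

open Matrix in
/-- The discounted energy `∑_{l<T} ρ ^ l ⟨(Aᵀ) ^ l v, z⟩²`. -/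
noncomputable def energy {p : ℕ} (A : Matrix (Fin p) (Fin p) ℝ) (v : Fin p → ℝ) (ρ : ℝ) (T : ℕ)
    (z : Fin p → ℝ) : ℝ :=
  ∑ l ∈ Finset.range T, ρ ^ l * (backward A v l ⬝ᵥ z) ^ 2

open Matrix in
/-- The trace of the quadratic form `energy`. -/
noncomputable def energyTrace {p : ℕ} (A : Matrix (Fin p) (Fin p) ℝ) (v : Fin p → ℝ) (ρ : ℝ)
    (T : ℕ) : ℝ :=
  ∑ l ∈ Finset.range T, ρ ^ l * (backward A v l ⬝ᵥ backward A v l)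

open Matrix in
@[fun_prop]
lemma measurable_dotProduct_left {p : ℕ} {E : Type*} [MeasurableSpace E] (v : Fin p → ℝ)
    {f : E → Fin p → ℝ} (hf : Measurable f) : Measurable fun e => v ⬝ᵥ f e := by
  unfold dotProduct
  fun_prop

open Matrix in
@[fun_prop]
lemma measurable_mulVec_left {p : ℕ} {E : Type*} [MeasurableSpace E]
    (A : Matrix (Fin p) (Fin p) ℝ) {f : E → Fin p → ℝ} (hf : Measurable f) :
    Measurable fun e => A *ᵥ f e :=
  measurable_pi_lambda _ fun i => measurable_dotProduct_left (A i) hf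

@[fun_prop]
lemma measurable_energy {p : ℕ} {E : Type*} [MeasurableSpace E] (A : Matrix (Fin p) (Fin p) ℝ)
    (v : Fin p → ℝ) (ρ : ℝ) (T : ℕ) {f : E → Fin p → ℝ} (hf : Measurable f) :
    Measurable fun e => energy A v ρ T (f e) := by
  unfold energy
  fun_prop

open Matrix in
-- The identity that closes the backward recursion: the square at the current time plus the
-- discounted energy of the propagated state is again an energy, one term longer.
lemma energy_succ {p : ℕ} (A : Matrix (Fin p) (Fin p) ℝ) (v : Fin p → ℝ) (ρ : ℝ) (T : ℕ)
    (z : Fin p → ℝ) :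
    energy A v ρ (T + 1) z = (v ⬝ᵥ z) ^ 2 + ρ * energy A v ρ T (A *ᵥ z) := by
  simp only [energy, Finset.sum_range_succ', Finset.mul_sum, backward_dotProduct_mulVec,
    backward_zero, pow_zero, one_mul]
  rw [add_comm]
  congr 1
  exact Finset.sum_congr rfl fun l _ => by ring

lemma energy_nonneg {p : ℕ} (A : Matrix (Fin p) (Fin p) ℝ) (v : Fin p → ℝ) {ρ : ℝ} (hρ : 0 ≤ ρ)
    (T : ℕ) (z : Fin p → ℝ) : 0 ≤ energy A v ρ T z :=
  Finset.sum_nonneg fun _ _ => by positivity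

lemma neg_log_one_sub_half_le {z : ℝ} (hz : |z| ≤ 1 / 6) :
    -Real.log (1 - z) / 2 ≤ z / 2 + 3 / 5 * z ^ 2 := by
  have h1 := abs_le.1 hz
  have h2 : 0 < 1 - z := by linarith
  have h3 := Real.one_sub_inv_le_log_of_pos h2
  have h4 : (1 - z)⁻¹ ≤ 1 + z + 6 / 5 * z ^ 2 := by
    rw [inv_le_iff_one_le_mul₀ h2]
    nlinarith [sq_nonneg z]
  linarith

lemma geom_sum_le_inv {b c : ℝ} (hb : 0 ≤ b) (hc : 0 < c) (hbc : b ≤ 1 - c) (T : ℕ) :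
    ∑ l ∈ Finset.range T, b ^ l ≤ 1 / c := by
  have h0 := mul_neg_geom_sum b T
  have := pow_nonneg hb T
  have h1 : 0 ≤ ∑ l ∈ Finset.range T, b ^ l := Finset.sum_nonneg fun _ _ => pow_nonneg hb _
  rw [le_div_iff₀ hc]
  nlinarith

lemma sum_mul_geom_le {b c : ℝ} (hb : 0 ≤ b) (hc : 0 < c) (hbc : b ≤ 1 - c) (T : ℕ) :
    ∑ l ∈ Finset.range T, (l : ℝ) * b ^ l ≤ 1 / c ^ 2 := by
  have hb1 : ‖b‖ < 1 := by rw [Real.norm_of_nonneg hb]; linarith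
  have h1 := hasSum_coe_mul_geometric_of_norm_lt_one hb1
  refine (sum_le_hasSum _ (fun l _ => by positivity) h1).trans ?_
  have h2 : c ≤ 1 - b := by linarith
  exact div_le_div₀ zero_le_one (by linarith) (by positivity) (by gcongr)

/-- Factor `ρ^l - 1 = (ρ - 1) ∑ ρ^i`. As `ρ` may exceed `1`, each `ρ^i` is paired with `i` of the
factors `b`, at rate `ρ * b ≤ β`. -/
lemma abs_pow_sub_one_mul_le {ρ b β : ℝ} (hρ : 0 ≤ ρ) (hb : 0 ≤ b) (h1 : b ≤ β)
    (h2 : ρ * b ≤ β) (l : ℕ) : |ρ ^ l - 1| * b ^ l ≤ |ρ - 1| * (l * β ^ l) := by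
  have hβ : 0 ≤ β := hb.trans h1
  have h3 : (∑ i ∈ Finset.range l, ρ ^ i) * b ^ l ≤ l * β ^ l := by
    rw [Finset.sum_mul]
    calc ∑ i ∈ Finset.range l, ρ ^ i * b ^ l ≤ ∑ _i ∈ Finset.range l, β ^ l := by
          refine Finset.sum_le_sum fun i hi => ?_
          obtain ⟨j, rfl⟩ := Nat.exists_eq_add_of_lt (Finset.mem_range.1 hi)
          have e1 : ρ ^ i * b ^ (i + j + 1) = (ρ * b) ^ i * b ^ (j + 1) := by ring
          have e2 : β ^ (i + j + 1) = β ^ i * β ^ (j + 1) := by ring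
          rw [e1, e2]
          gcongr
      _ = l * β ^ l := by simp
  rw [← geom_sum_mul ρ l, abs_mul,
    abs_of_nonneg (Finset.sum_nonneg fun i _ => pow_nonneg hρ i)]
  calc _ = |ρ - 1| * ((∑ i ∈ Finset.range l, ρ ^ i) * b ^ l) := by ring
    _ ≤ _ := by gcongr

namespace StableLyapunov

open Matrix

variable {p : ℕ} {η D : ℝ} {A Q : Matrix (Fin p) (Fin p) ℝ}

/-- The trace of the discounted energy approximates the stationary variance. -/
lemma abs_energyTrace_sub_le (h : StableLyapunov η D A Q) (v : Fin p → ℝ) {ρ : ℝ} (hρ : 0 ≤ ρ)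
    (hρ1 : |ρ - 1| ≤ η * D / 5) (T : ℕ) :
    |η * energyTrace A v ρ T - v ⬝ᵥ (Q *ᵥ v)|
      ≤ η * (|ρ - 1| * (16 / 9 / (η * D) ^ 2)) * (v ⬝ᵥ v)
        + (1 - η * D) ^ T * ((v ⬝ᵥ v) / D) := by
  have hκ := mul_pos h.step_pos h.rate_pos
  have hκ1 := h.rate_le
  have hη := h.step_pos
  have hD := h.rate_pos
  set κ := η * D with hκdef
  have hN : 0 ≤ v ⬝ᵥ v := dotProduct_self_nonneg v
  have hρκ := (abs_le.1 hρ1).2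
  have e1 : η * energyTrace A v ρ T - v ⬝ᵥ (Q *ᵥ v)
      = η * ∑ l ∈ Finset.range T, (ρ ^ l - 1) * (backward A v l ⬝ᵥ backward A v l)
        - backward A v T ⬝ᵥ (Q *ᵥ backward A v T) := by
    rw [h.bilin_telescope v v T, energyTrace]
    simp only [sub_mul, one_mul, Finset.sum_sub_distrib]
    ring
  -- From `ρ ≤ 1 + κ/5` follows `ρ (1 - κ) ≤ 1 - 3κ/4`, and `∑ l (1 - 3κ/4)^l ≤ (3κ/4)⁻²` produces
  -- the constant `16/9`.
  have h1 : |∑ l ∈ Finset.range T, (ρ ^ l - 1) * (backward A v l ⬝ᵥ backward A v l)|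
      ≤ |ρ - 1| * (16 / 9 / κ ^ 2) * (v ⬝ᵥ v) := by
    calc _ ≤ ∑ l ∈ Finset.range T, |ρ - 1| * (l * (1 - 3 / 4 * κ) ^ l) * (v ⬝ᵥ v) := by
          refine (Finset.abs_sum_le_sum_abs _ _).trans (Finset.sum_le_sum fun l _ => ?_)
          rw [abs_mul, abs_of_nonneg (dotProduct_self_nonneg (backward A v l))]
          calc _ ≤ |ρ ^ l - 1| * ((1 - κ) ^ l * (v ⬝ᵥ v)) :=
                mul_le_mul_of_nonneg_left (h.backward_dotProduct_self_le v l) (abs_nonneg _)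
            _ = |ρ ^ l - 1| * (1 - κ) ^ l * (v ⬝ᵥ v) := by ring
            _ ≤ _ := mul_le_mul_of_nonneg_right
                (abs_pow_sub_one_mul_le hρ (by linarith) (by linarith) (by nlinarith) l) hN
      _ = |ρ - 1| * (∑ l ∈ Finset.range T, l * (1 - 3 / 4 * κ) ^ l) * (v ⬝ᵥ v) := by
          rw [Finset.mul_sum, Finset.sum_mul]
      _ ≤ |ρ - 1| * (1 / (3 / 4 * κ) ^ 2) * (v ⬝ᵥ v) := by
          gcongr
          exact sum_mul_geom_le (by linarith) (by positivity) le_rfl T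
      _ = _ := by congr 2; field_simp; norm_num
  have h2 : backward A v T ⬝ᵥ (Q *ᵥ backward A v T) ≤ (1 - κ) ^ T * ((v ⬝ᵥ v) / D) := by
    refine (h.quad_le _).trans ?_
    rw [← mul_div_assoc]
    gcongr
    exact h.backward_dotProduct_self_le v T
  have h3 := h.quad_nonneg (backward A v T)
  rw [e1]
  refine (abs_sub _ _).trans ?_
  rw [abs_mul, abs_of_pos hη, abs_of_nonneg h3, mul_assoc η]
  gcongr

lemma energyTrace_le (h : StableLyapunov η D A Q) (v : Fin p → ℝ) {ρ : ℝ} (hρ : 0 ≤ ρ)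
    (hρ1 : |ρ - 1| ≤ η * D / 5) (T : ℕ) :
    energyTrace A v ρ T ≤ 4 / 3 * (v ⬝ᵥ v) / (η * D) := by
  have hκ := mul_pos h.step_pos h.rate_pos
  have hκ1 := h.rate_le
  have hN : 0 ≤ v ⬝ᵥ v := dotProduct_self_nonneg v
  have hρκ := (abs_le.1 hρ1).2
  calc energyTrace A v ρ T
      ≤ ∑ l ∈ Finset.range T, (ρ * (1 - η * D)) ^ l * (v ⬝ᵥ v) := by
        refine Finset.sum_le_sum fun l _ => ?_
        rw [mul_pow, mul_assoc]
        exact mul_le_mul_of_nonneg_left (h.backward_dotProduct_self_le v l) (pow_nonneg hρ l)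
    _ = (∑ l ∈ Finset.range T, (ρ * (1 - η * D)) ^ l) * (v ⬝ᵥ v) := by rw [Finset.sum_mul]
    _ ≤ 1 / (3 / 4 * (η * D)) * (v ⬝ᵥ v) := by
        gcongr
        exact geom_sum_le_inv (mul_nonneg hρ (by linarith)) (by positivity) (by nlinarith) T
    _ = _ := by field_simp

lemma energyTrace_nonneg (v : Fin p → ℝ) {ρ : ℝ} (hρ : 0 ≤ ρ) (T : ℕ) :
    0 ≤ energyTrace A v ρ T :=
  Finset.sum_nonneg fun l _ => mul_nonneg (pow_nonneg hρ l) (dotProduct_self_nonneg _)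

end StableLyapunov

/-! ### Exponential moments of the empirical second moments -/

namespace StationaryTrajectory

open Matrix

variable {p : ℕ} {Ω : Type*} [MeasurableSpace Ω] {P : Measure Ω} [IsProbabilityMeasure P]
  {η D : ℝ} {Θ Q : Matrix (Fin p) (Fin p) ℝ} {x w : ℕ → Ω → Fin p → ℝ}

/-- All terms of the energy see the same noise vector, hence the need for a moment bound under
arbitrary dependence. The total variance is `η` times the trace. -/
lemma lintegral_exp_energy_noise_le (h : StationaryTrajectory P η Θ x w) (hη : 0 < η)
    (v : Fin p → ℝ) {ρ : ℝ} (hρ : 0 ≤ ρ) {s : ℝ} (T t : ℕ)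
    (hs : 2 * η * s * energyTrace (1 + η • Θ) v ρ T < 1) (z : Fin p → ℝ) :
    ∫⁻ ω, ENNReal.ofReal (Real.exp (s * energy (1 + η • Θ) v ρ T (z + w (t + 1) ω))) ∂P
      ≤ ENNReal.ofReal (Real.exp (-Real.log (1 - 2 * η * s * energyTrace (1 + η • Θ) v ρ T) / 2
          + s * energy (1 + η • Θ) v ρ T z
            / (1 - 2 * η * s * energyTrace (1 + η • Θ) v ρ T))) := by
  set A := 1 + η • Θ
  have hν : ∀ l, ((η * (backward A v l ⬝ᵥ backward A v l)).toNNReal : ℝ)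
      = η * (backward A v l ⬝ᵥ backward A v l) := fun l =>
    Real.coe_toNNReal _ (mul_nonneg hη.le (dotProduct_self_nonneg _))
  have e1 : 2 * s * ∑ l ∈ Finset.range T,
      ρ ^ l * ((η * (backward A v l ⬝ᵥ backward A v l)).toNNReal : ℝ)
      = 2 * η * s * energyTrace A v ρ T := by
    simp only [hν, energyTrace, Finset.mul_sum]
    exact Finset.sum_congr rfl fun l _ => by ring
  have h1 := lintegral_exp_sum_sq_gaussian_le (P := P) (Finset.range T)
    (X := fun l ω => backward A v l ⬝ᵥ w (t + 1) ω)
    (fun l => h.hasLaw_noise hη t (backward A v l)) (c := fun l => ρ ^ l)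
    (fun l => pow_nonneg hρ l) (m := fun l => backward A v l ⬝ᵥ z) (fun l hl => ?_) (a := s)
    (by rw [e1]; exact hs)
  · rw [e1] at h1
    simpa only [energy, dotProduct_add] using h1
  · have h2 := hν l
    rw [hl, NNReal.coe_zero] at h2
    have h3 : backward A v l ⬝ᵥ backward A v l = 0 := by
      rcases mul_eq_zero.1 h2.symm with h | h
      · exact absurd h hη.ne'
      · exact h
    rw [dotProduct_self_eq_zero.1 h3, zero_dotProduct]

/-- The partial sums of squares along `v` completed by the discounted energy of the last state. -/
noncomputable def completedMoment (P : Measure Ω) (A : Matrix (Fin p) (Fin p) ℝ)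
    (x : ℕ → Ω → Fin p → ℝ) (v : Fin p → ℝ) (ρ s : ℝ) (T t : ℕ) : ENNReal :=
  ∫⁻ ω, ENNReal.ofReal (Real.exp (s * ∑ a ∈ Finset.range t, (v ⬝ᵥ x a ω) ^ 2
    + s * energy A v ρ T (x t ω))) ∂P

/-- Integrating out `w (t + 1)` costs the logarithmic factor and divides the energy by `g`.
Condition `hsρ` lets `ρ` absorb `1 / g` for either sign of `s`, and `energy_succ` restores the shape
of the exponent. -/
lemma completedMoment_succ_le (h : StationaryTrajectory P η Θ x w) (hη : 0 < η)
    (v : Fin p → ℝ) {ρ : ℝ} (hρ : 0 ≤ ρ) {s : ℝ} (T t : ℕ)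
    (hs : 2 * η * s * energyTrace (1 + η • Θ) v ρ T < 1)
    (hsρ : s ≤ s * ρ * (1 - 2 * η * s * energyTrace (1 + η • Θ) v ρ T)) :
    completedMoment P (1 + η • Θ) x v ρ s T (t + 1)
      ≤ ENNReal.ofReal
          (Real.exp (-Real.log (1 - 2 * η * s * energyTrace (1 + η • Θ) v ρ T) / 2))
        * completedMoment P (1 + η • Θ) x v ρ s (T + 1) t := by
  set A := 1 + η • Θ with hA
  set g := 1 - 2 * η * s * energyTrace A v ρ T with hg
  have hg0 : 0 < g := by linarith
  let G : (ℕ → Fin p → ℝ) → (Fin p → ℝ) → ENNReal := fun z y =>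
    ENNReal.ofReal (Real.exp (s * ∑ a ∈ Finset.range (t + 1), (v ⬝ᵥ z a) ^ 2)) *
      ENNReal.ofReal (Real.exp (s * energy A v ρ T (A *ᵥ z t + y)))
  have hG : Measurable (Function.uncurry G) := by
    simp only [G, Function.uncurry_def]
    fun_prop
  have hsum : ∀ ω, ∑ a ∈ Finset.range (t + 1), (v ⬝ᵥ x (min a t) ω) ^ 2
      = ∑ a ∈ Finset.range (t + 1), (v ⬝ᵥ x a ω) ^ 2 := fun ω =>
    Finset.sum_congr rfl fun a ha => by
      rw [min_eq_left (Nat.lt_succ_iff.1 (Finset.mem_range.1 ha))]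
  have e1 : completedMoment P A x v ρ s T (t + 1)
      = ∫⁻ ω, G (fun a => x (min a t) ω) (w (t + 1) ω) ∂P := by
    refine lintegral_congr fun ω => ?_
    simp only [G]
    rw [← ENNReal.ofReal_mul (Real.exp_pos _).le, ← Real.exp_add, min_self, hsum, hA, ← h.step_eq]
  rw [e1, h.lintegral_step t hG, completedMoment, ← lintegral_const_mul]
  · refine lintegral_mono fun ω => ?_
    simp only [G]
    rw [lintegral_const_mul _ (by
      have := h.meas_noise t
      fun_prop), min_self, hsum]
    refine (mul_le_mul_right (h.lintegral_exp_energy_noise_le hη v hρ T t hs _) _).trans ?_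
    rw [← ENNReal.ofReal_mul (Real.exp_pos _).le, ← ENNReal.ofReal_mul (Real.exp_pos _).le,
      ← Real.exp_add, ← Real.exp_add]
    refine ENNReal.ofReal_le_ofReal (Real.exp_le_exp.2 ?_)
    have h1 : s * energy A v ρ T (A *ᵥ x t ω) / g ≤ s * ρ * energy A v ρ T (A *ᵥ x t ω) := by
      rw [div_le_iff₀ hg0]
      have := mul_le_mul_of_nonneg_right hsρ (energy_nonneg A v hρ T (A *ᵥ x t ω))
      linarith
    rw [energy_succ, Finset.sum_range_succ]
    linarith
  · have h1 := h.measurable_apply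
    fun_prop

lemma completedMoment_le (h : StationaryTrajectory P η Θ x w) (hη : 0 < η)
    (v : Fin p → ℝ) {ρ : ℝ} (hρ : 0 ≤ ρ) {s : ℝ}
    (hs : ∀ T, 2 * η * s * energyTrace (1 + η • Θ) v ρ T < 1)
    (hsρ : ∀ T, s ≤ s * ρ * (1 - 2 * η * s * energyTrace (1 + η • Θ) v ρ T)) (n T : ℕ) :
    completedMoment P (1 + η • Θ) x v ρ s T n
      ≤ ENNReal.ofReal (Real.exp (∑ j ∈ Finset.range n,
          -Real.log (1 - 2 * η * s * energyTrace (1 + η • Θ) v ρ (T + j)) / 2))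
        * completedMoment P (1 + η • Θ) x v ρ s (T + n) 0 := by
  induction n generalizing T with
  | zero => simp
  | succ n ih =>
    refine (h.completedMoment_succ_le hη v hρ T n (hs T) (hsρ T)).trans ?_
    refine (mul_le_mul_right (ih (T + 1)) _).trans (le_of_eq ?_)
    rw [← mul_assoc, ← ENNReal.ofReal_mul (Real.exp_pos _).le, ← Real.exp_add,
      Finset.sum_range_succ', add_comm (-_ / 2), add_zero]
    simp only [add_assoc, add_comm 1]

/-- Only the Gaussian initial state is left, with total variance at most the trace over `D`. The
exponent `1/10` is `1/12 + (3/5)/36`, the logarithm estimate at `1/6`. -/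
lemma completedMoment_zero_le (h : StationaryTrajectory P η Θ x w)
    (hst : StableLyapunov η D (1 + η • Θ) Q) (v : Fin p → ℝ) {ρ : ℝ} (hρ : 0 ≤ ρ) {s : ℝ} (T : ℕ)
    (hs : 2 * |s| * (energyTrace (1 + η • Θ) v ρ T / D) ≤ 1 / 6) :
    completedMoment P (1 + η • Θ) x v ρ s T 0 ≤ ENNReal.ofReal (Real.exp (1 / 10)) := by
  set A := 1 + η • Θ
  have hν : ∀ l, ((backward A v l ⬝ᵥ (Q *ᵥ backward A v l)).toNNReal : ℝ)
      = backward A v l ⬝ᵥ (Q *ᵥ backward A v l) := fun l =>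
    Real.coe_toNNReal _ (hst.quad_nonneg _)
  set ι := ∑ l ∈ Finset.range T,
    ρ ^ l * ((backward A v l ⬝ᵥ (Q *ᵥ backward A v l)).toNNReal : ℝ) with hι
  have hι0 : 0 ≤ ι := Finset.sum_nonneg fun l _ => mul_nonneg (pow_nonneg hρ l) (NNReal.coe_nonneg _)
  have hι1 : ι ≤ energyTrace A v ρ T / D := by
    rw [hι, energyTrace, Finset.sum_div]
    refine Finset.sum_le_sum fun l _ => ?_
    rw [hν, mul_div_assoc]
    exact mul_le_mul_of_nonneg_left (hst.quad_le _) (pow_nonneg hρ l)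
  have habs : |2 * s * ι| ≤ 1 / 6 := by
    rw [abs_mul, abs_mul, abs_two, abs_of_nonneg hι0]
    exact (mul_le_mul_of_nonneg_left hι1 (by positivity)).trans hs
  have h1 := lintegral_exp_sum_sq_gaussian_le (P := P) (Finset.range T)
    (X := fun l ω => backward A v l ⬝ᵥ x 0 ω)
    (fun l => h.hasLaw_init hst (backward A v l)) (c := fun l => ρ ^ l)
    (fun l => pow_nonneg hρ l) (m := fun _ => 0) (fun _ _ => rfl) (a := s)
    (by linarith [(abs_le.1 habs).2])
  have h2 : completedMoment P A x v ρ s T 0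
      = ∫⁻ ω, ENNReal.ofReal (Real.exp (s * ∑ l ∈ Finset.range T,
          ρ ^ l * (0 + backward A v l ⬝ᵥ x 0 ω) ^ 2)) ∂P := by
    simp [completedMoment, energy]
  rw [h2]
  refine h1.trans (ENNReal.ofReal_le_ofReal (Real.exp_le_exp.2 ?_))
  have h3 := neg_log_one_sub_half_le habs
  have h4 := abs_le.1 habs
  simp only [ne_eq, OfNat.ofNat_ne_zero, not_false_eq_true, zero_pow, mul_zero,
    Finset.sum_const_zero, zero_div, add_zero]
  nlinarith

/-- The exponential moment of the empirical second moment in the direction `v`. -/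
lemma lintegral_exp_sum_sq_le (h : StationaryTrajectory P η Θ x w)
    (hst : StableLyapunov η D (1 + η • Θ) Q) (v : Fin p → ℝ) {s : ℝ}
    (hs : 16 * |s| * (v ⬝ᵥ v) ≤ η * D ^ 2) (n : ℕ) :
    ∫⁻ ω, ENNReal.ofReal (Real.exp (s * ∑ t ∈ Finset.range n, (v ⬝ᵥ x t ω) ^ 2)) ∂P
      ≤ ENNReal.ofReal (Real.exp (n * (s * (v ⬝ᵥ (Q *ᵥ v)))
          + n * (10 * s ^ 2 * (v ⬝ᵥ v) ^ 2 / (η * D ^ 3)) + 1 / 2)) := by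
  have hη := hst.step_pos
  have hD := hst.rate_pos
  have hκ := mul_pos hη hD
  have hκ1 := hst.rate_le
  set A := 1 + η • Θ with hA
  set N := v ⬝ᵥ v with hN
  have hN0 : 0 ≤ N := dotProduct_self_nonneg v
  set τ := 4 / 3 * N / (η * D) with hτ
  have hτ0 : 0 ≤ τ := by positivity
  set y := 2 * η * s * τ with hy
  have hyeq : y = 8 / 3 * s * N / D := by rw [hy, hτ]; field_simp; ring
  have hyabs : |y| = 8 / 3 * |s| * N / D := by
    rw [hyeq, abs_div, abs_mul, abs_mul, abs_of_nonneg hN0, abs_of_pos hD,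
      abs_of_pos (by norm_num : (0 : ℝ) < 8 / 3)]
  have hyκ : |y| ≤ η * D / 6 := by
    rw [hyabs, div_le_iff₀ hD]
    nlinarith
  have hy6 : |y| ≤ 1 / 6 := by linarith
  have hy6' := abs_le.1 hy6
  have h1y : 0 < 1 - y := by linarith
  -- `τ` bounds all traces uniformly in `T`, and `ρ` is the exact reciprocal of the loss `1 - y` at
  -- `τ`. Replacing `τ` by a smaller trace changes `s * ρ * (1 - ·)` by a multiple of `s²`, so one
  -- `ρ` serves all steps and both signs.
  set ρ := 1 / (1 - y) with hρdef
  have hρ : 0 ≤ ρ := by positivity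
  have hρy : ρ * (1 - y) = 1 := by rw [hρdef]; field_simp
  have hρ1 : |ρ - 1| ≤ 6 / 5 * |y| := by
    have : ρ - 1 = y / (1 - y) := by rw [hρdef]; field_simp; ring
    rw [this, abs_div, abs_of_pos h1y, div_le_iff₀ h1y]
    nlinarith [abs_nonneg y]
  have hρκ : |ρ - 1| ≤ η * D / 5 := by linarith
  have hτT := fun T => hst.energyTrace_le v hρ hρκ T
  have hτT0 := fun T => StableLyapunov.energyTrace_nonneg (A := A) v hρ T
  have hyT : ∀ T, |2 * η * s * energyTrace A v ρ T| ≤ |y| := by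
    intro T
    rw [hy, abs_mul, abs_mul (2 * η * s), abs_of_nonneg (hτT0 T), abs_of_nonneg hτ0]
    exact mul_le_mul_of_nonneg_left (hτT T) (abs_nonneg _)
  have hs1 : ∀ T, 2 * η * s * energyTrace A v ρ T < 1 := fun T => by
    linarith [le_abs_self (2 * η * s * energyTrace A v ρ T), hyT T]
  have hs2 : ∀ T, s ≤ s * ρ * (1 - 2 * η * s * energyTrace A v ρ T) := fun T => by
    have h1 : s * ρ * (1 - 2 * η * s * energyTrace A v ρ T)
        = s * (ρ * (1 - y)) + 2 * η * ρ * s ^ 2 * (τ - energyTrace A v ρ T) := by rw [hy]; ring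
    rw [h1, hρy, mul_one]
    have : 0 ≤ 2 * η * ρ * s ^ 2 * (τ - energyTrace A v ρ T) :=
      mul_nonneg (by positivity) (sub_nonneg.2 (hτT T))
    linarith
  have h0 := h.completedMoment_le hη v hρ hs1 hs2 n 0
  have hbound : s ^ 2 * N ^ 2 / D ^ 2 ≤ s ^ 2 * N ^ 2 / (η * D ^ 3) := by
    gcongr
    nlinarith [pow_pos hD 2]
  -- The linear term gives the mean. The bias of the discount contributes `256/45` and the second
  -- order of the logarithm `64/15`, together below `10`; the truncation error is geometric in `T`
  -- and stays bounded after summation.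
  have hL : ∀ T, -Real.log (1 - 2 * η * s * energyTrace A v ρ T) / 2
      ≤ s * (v ⬝ᵥ (Q *ᵥ v)) + 10 * s ^ 2 * N ^ 2 / (η * D ^ 3)
        + (1 - η * D) ^ T * (|s| * N / D) := by
    intro T
    have h1 := neg_log_one_sub_half_le ((hyT T).trans hy6)
    have h2 : (2 * η * s * energyTrace A v ρ T) ^ 2 ≤ y ^ 2 := sq_le_sq.2 (hyT T)
    have h3 : y ^ 2 = 64 / 9 * (s ^ 2 * N ^ 2 / D ^ 2) := by rw [hyeq]; ring
    have h4 : 2 * η * s * energyTrace A v ρ T / 2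
        = s * (v ⬝ᵥ (Q *ᵥ v)) + s * (η * energyTrace A v ρ T - v ⬝ᵥ (Q *ᵥ v)) := by ring
    have h5 : s * (η * energyTrace A v ρ T - v ⬝ᵥ (Q *ᵥ v))
        ≤ |s| * (η * (|ρ - 1| * (16 / 9 / (η * D) ^ 2)) * N + (1 - η * D) ^ T * (N / D)) := by
      refine (le_abs_self _).trans ?_
      rw [abs_mul]
      exact mul_le_mul_of_nonneg_left (hst.abs_energyTrace_sub_le v hρ hρκ T) (abs_nonneg _)
    have h6 : |s| * (η * (|ρ - 1| * (16 / 9 / (η * D) ^ 2)) * N)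
        ≤ 256 / 45 * (s ^ 2 * N ^ 2 / (η * D ^ 3)) := by
      calc |s| * (η * (|ρ - 1| * (16 / 9 / (η * D) ^ 2)) * N)
          ≤ |s| * (η * (6 / 5 * (8 / 3 * |s| * N / D) * (16 / 9 / (η * D) ^ 2)) * N) := by
            rw [hyabs] at hρ1
            gcongr
        _ = 256 / 45 * (|s| ^ 2 * N ^ 2 / (η * D ^ 3)) := by field_simp; ring
        _ = _ := by rw [sq_abs]
    have h7 : 0 ≤ s ^ 2 * N ^ 2 / (η * D ^ 3) := by positivity
    have h8 : 10 * s ^ 2 * N ^ 2 / (η * D ^ 3) = 10 * (s ^ 2 * N ^ 2 / (η * D ^ 3)) := by ring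
    have h9 : (1 - η * D) ^ T * (|s| * N / D) = |s| * ((1 - η * D) ^ T * (N / D)) := by ring
    rw [h8, h9]
    nlinarith
  have hsum : ∑ T ∈ Finset.range n, -Real.log (1 - 2 * η * s * energyTrace A v ρ T) / 2
      ≤ n * (s * (v ⬝ᵥ (Q *ᵥ v))) + n * (10 * s ^ 2 * N ^ 2 / (η * D ^ 3)) + 1 / 16 := by
    refine (Finset.sum_le_sum fun T _ => hL T).trans ?_
    rw [Finset.sum_add_distrib, ← Finset.sum_mul]
    have h1 := geom_sum_le_inv (by linarith) hκ le_rfl n (b := 1 - η * D)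
    have h2 : (∑ T ∈ Finset.range n, (1 - η * D) ^ T) * (|s| * N / D) ≤ 1 / 16 := by
      calc _ ≤ 1 / (η * D) * (|s| * N / D) := by gcongr
        _ = (|s| * N) / (η * D ^ 2) := by field_simp
        _ ≤ 1 / 16 := by
          rw [div_le_iff₀ (by positivity)]
          linarith
    simp only [Finset.sum_const, Finset.card_range, nsmul_eq_mul]
    linarith
  have hinit := h.completedMoment_zero_le hst v hρ (s := s) n (by
    calc 2 * |s| * (energyTrace A v ρ n / D) ≤ 2 * |s| * (τ / D) := by gcongr; exact hτT n
      _ = 8 / 3 * (|s| * N) / (η * D ^ 2) := by rw [hτ]; field_simp; ring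
      _ ≤ 1 / 6 := by
        rw [div_le_iff₀ (by positivity)]
        linarith)
  have e0 : completedMoment P A x v ρ s 0 n
      = ∫⁻ ω, ENNReal.ofReal (Real.exp (s * ∑ t ∈ Finset.range n, (v ⬝ᵥ x t ω) ^ 2)) ∂P := by
    simp [completedMoment, energy]
  rw [← e0]
  refine h0.trans ?_
  simp only [zero_add]
  refine (mul_le_mul_right hinit _).trans ?_
  rw [← ENNReal.ofReal_mul (Real.exp_pos _).le, ← Real.exp_add]
  refine ENNReal.ofReal_le_ofReal (Real.exp_le_exp.2 ?_)
  linarith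

end StationaryTrajectory

/-! ### Concentration of second moments and gradient -/

/-- The exponential Markov inequality. -/
lemma measure_ge_le_of_lintegral_exp_le {Ω : Type*} [MeasurableSpace Ω] {P : Measure Ω}
    {Y : Ω → ℝ} (hY : Measurable Y) {b c : ℝ}
    (h : ∫⁻ ω, ENNReal.ofReal (Real.exp (Y ω)) ∂P ≤ ENNReal.ofReal (Real.exp b)) :
    P {ω | c ≤ Y ω} ≤ ENNReal.ofReal (Real.exp (b - c)) := by
  have h1 := mul_meas_ge_le_lintegral (μ := P)
    (f := fun ω => ENNReal.ofReal (Real.exp (Y ω))) (by fun_prop) (ENNReal.ofReal (Real.exp c))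
  have h2 : {ω | ENNReal.ofReal (Real.exp c) ≤ ENNReal.ofReal (Real.exp (Y ω))}
      = {ω | c ≤ Y ω} := by
    ext ω
    simp [ENNReal.ofReal_le_ofReal_iff (Real.exp_pos _).le]
  rw [h2] at h1
  have h3 : ENNReal.ofReal (Real.exp c) ≠ 0 := by simp [Real.exp_pos]
  rw [Real.exp_sub, ENNReal.ofReal_div_of_pos (Real.exp_pos _),
    ENNReal.le_div_iff_mul_le (Or.inl h3) (Or.inl ENNReal.ofReal_ne_top), mul_comm]
  exact h1.trans h

lemma exp_half_le_two : Real.exp (1 / 2) ≤ 2 := by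
  have h1 := Real.exp_one_lt_d9
  have h2 : Real.exp (1 / 2) ^ 2 = Real.exp 1 := by rw [← Real.exp_nat_mul]; norm_num
  nlinarith [Real.exp_pos (1 / 2)]

namespace StationaryTrajectory

open Matrix

variable {p : ℕ} {Ω : Type*} [MeasurableSpace Ω] {P : Measure Ω}
  {η D : ℝ} {Θ Q : Matrix (Fin p) (Fin p) ℝ} {x w : ℕ → Ω → Fin p → ℝ}

lemma lintegral_exp_mul_noise (h : StationaryTrajectory P η Θ x w) (hη : 0 < η) (t : ℕ)
    (r : Fin p) (c : ℝ) :
    ∫⁻ ω, ENNReal.ofReal (Real.exp (c * w (t + 1) ω r)) ∂P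
      = ENNReal.ofReal (Real.exp (η * c ^ 2 / 2)) := by
  have hlaw := h.noise_law t r
  have hmgf := mgf_gaussianReal hlaw.map_eq c
  rw [Real.coe_toNNReal _ hη.le, zero_mul, zero_add] at hmgf
  rw [← hmgf, mgf, ofReal_integral_eq_lintegral_ofReal]
  -- Without integrability the integral would be `0` by default, but it is a positive exponential.
  · by_contra hcon
    have h1 : mgf (fun ω => w (t + 1) ω r) P c = 0 := integral_undef hcon
    rw [h1] at hmgf
    exact absurd hmgf (Real.exp_pos _).ne
  · exact Filter.Eventually.of_forall fun ω => (Real.exp_pos _).le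

variable [IsProbabilityMeasure P]

/-- One-sided concentration of the empirical second moment in a direction, the side being the
sign of `s₀`. -/
lemma measure_sum_sq_deviation_le (h : StationaryTrajectory P η Θ x w)
    (hst : StableLyapunov η D (1 + η • Θ) Q) (v : Fin p → ℝ) {N d : ℝ} (hN : 0 < N)
    (hv : v ⬝ᵥ v ≤ N) (hd : 0 < d) (hdN : D * d ≤ N) (n : ℕ) {s₀ : ℝ} (hs₀ : |s₀| = 1) :
    P {ω | n * d ≤ s₀ * (∑ t ∈ Finset.range n, (v ⬝ᵥ x t ω) ^ 2 - n * (v ⬝ᵥ (Q *ᵥ v)))}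
      ≤ ENNReal.ofReal (2 * Real.exp (-(n * η * D ^ 3 * d ^ 2 / (40 * N ^ 2)))) := by
  have hη := hst.step_pos
  have hD := hst.rate_pos
  have hv0 : 0 ≤ v ⬝ᵥ v := dotProduct_self_nonneg v
  -- The minimizer of `10 s² N² / (η D³) - s d`; `D * d ≤ N` places it in the range of the moment
  -- bound.
  set s := d * η * D ^ 3 / (20 * N ^ 2) with hsdef
  have hs0 : 0 < s := by positivity
  have hsabs : |s₀ * s| = s := by rw [abs_mul, hs₀, one_mul, abs_of_pos hs0]
  have hsN : 16 * |s₀ * s| * (v ⬝ᵥ v) ≤ η * D ^ 2 := by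
    rw [hsabs]
    calc 16 * s * (v ⬝ᵥ v) ≤ 16 * s * N := by gcongr
      _ = 16 / 20 * (η * D ^ 2) * (D * d / N) := by rw [hsdef]; field_simp
      _ ≤ 16 / 20 * (η * D ^ 2) * 1 := by
        gcongr
        rwa [div_le_one hN]
      _ ≤ η * D ^ 2 := by nlinarith [mul_pos hη (pow_pos hD 2)]
  have h1 := h.lintegral_exp_sum_sq_le hst v hsN n
  have hmx := h.measurable_apply
  have h2 := measure_ge_le_of_lintegral_exp_le (c := n * (s * d)
    + n * (s₀ * s * (v ⬝ᵥ (Q *ᵥ v)))) (by fun_prop) h1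
  have hsub : {ω | n * d ≤ s₀ * (∑ t ∈ Finset.range n, (v ⬝ᵥ x t ω) ^ 2
        - n * (v ⬝ᵥ (Q *ᵥ v)))}
      ⊆ {ω | n * (s * d) + n * (s₀ * s * (v ⬝ᵥ (Q *ᵥ v)))
        ≤ s₀ * s * ∑ t ∈ Finset.range n, (v ⬝ᵥ x t ω) ^ 2} := by
    intro ω hω
    have h3 := mul_le_mul_of_nonneg_left (Set.mem_ofPred_eq ▸ hω : _ ≤ _) hs0.le
    simp only [Set.mem_ofPred_eq]
    linarith
  refine (measure_mono hsub).trans (h2.trans (ENNReal.ofReal_le_ofReal ?_))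
  have hsq : (s₀ * s) ^ 2 = s ^ 2 := by rw [← sq_abs, hsabs]
  have h4 : n * (10 * (s₀ * s) ^ 2 * (v ⬝ᵥ v) ^ 2 / (η * D ^ 3))
      ≤ n * (10 * s ^ 2 * N ^ 2 / (η * D ^ 3)) := by
    rw [hsq]
    gcongr
  have h5 : n * (10 * s ^ 2 * N ^ 2 / (η * D ^ 3)) - n * (s * d)
      = -(n * η * D ^ 3 * d ^ 2 / (40 * N ^ 2)) := by
    rw [hsdef]
    field_simp
    ring
  calc _ ≤ Real.exp (1 / 2 + -(n * η * D ^ 3 * d ^ 2 / (40 * N ^ 2))) := by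
        refine Real.exp_le_exp.2 ?_
        linarith
    _ ≤ _ := by
        rw [Real.exp_add]
        gcongr
        exact exp_half_le_two

lemma sum_mul_eq_polarization (n : ℕ) (y : ℕ → Fin p → ℝ) (i j : Fin p) :
    4 * (n * empCov n y i j)
      = ∑ t ∈ Finset.range n, ((Pi.single i 1 + Pi.single j 1) ⬝ᵥ y t) ^ 2
        - ∑ t ∈ Finset.range n, ((Pi.single i 1 - Pi.single j 1) ⬝ᵥ y t) ^ 2 := by
  rcases Nat.eq_zero_or_pos n with rfl | hn
  · simp
  · have hn' : (n : ℝ) ≠ 0 := by exact_mod_cast hn.ne'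
    rw [empCov, ← mul_assoc (n : ℝ), mul_one_div_cancel hn', one_mul, Finset.mul_sum,
      ← Finset.sum_sub_distrib]
    refine Finset.sum_congr rfl fun t _ => ?_
    simp only [add_dotProduct, sub_dotProduct, single_dotProduct, one_mul]
    ring

/-- Concentration of an entry of the empirical second moment matrix. -/
lemma measure_empCov_deviation_le (h : StationaryTrajectory P η Θ x w)
    (hst : StableLyapunov η D (1 + η • Θ) Q) {n : ℕ} (hn : n ≠ 0) (i j : Fin p) {ε : ℝ}
    (hε : 0 < ε) (hDε : D * ε ≤ 2) :
    P {ω | ε < |empCov n (fun t => x t ω) i j - Q i j|}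
      ≤ ENNReal.ofReal (8 * Real.exp (-(n * η * D ^ 3 * ε ^ 2 / 160))) := by
  have hn0 : (0 : ℝ) < n := by exact_mod_cast Nat.pos_of_ne_zero hn
  let u : Fin p → ℝ := Pi.single i 1 + Pi.single j 1
  let v : Fin p → ℝ := Pi.single i 1 - Pi.single j 1
  have hQuv : u ⬝ᵥ (Q *ᵥ u) - v ⬝ᵥ (Q *ᵥ v) = 4 * Q i j := by
    have hs := hst.symm i j
    simp only [u, v, mulVec_add, mulVec_sub, add_dotProduct, sub_dotProduct, single_dotProduct,
      dotProduct_add, dotProduct_sub, one_mul, mulVec_single_one, col_apply]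
    rw [hs]
    ring
  have hst01 : ∀ a b : Fin p, (Pi.single a 1 : Fin p → ℝ) ⬝ᵥ Pi.single b 1 ≤ 1 ∧
      0 ≤ (Pi.single a 1 : Fin p → ℝ) ⬝ᵥ Pi.single b 1 := by
    intro a b
    rw [single_one_dotProduct]
    by_cases hab : a = b
    · simp [hab]
    · simp [hab]
  have hu : u ⬝ᵥ u ≤ 4 := by
    simp only [u, add_dotProduct, dotProduct_add]
    linarith [(hst01 i i).1, (hst01 i j).1, (hst01 j i).1, (hst01 j j).1]
  have hv : v ⬝ᵥ v ≤ 4 := by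
    simp only [v, sub_dotProduct, dotProduct_sub]
    linarith [(hst01 i i).1, (hst01 i j).2, (hst01 j i).2, (hst01 j j).1]
  -- Polarization recovers four times an entry from two forms, so each may deviate by `2ε`; two
  -- directions with two sides give the prefactor `8`.
  have key : ∀ z : Fin p → ℝ, z ⬝ᵥ z ≤ 4 → ∀ s₀ : ℝ, |s₀| = 1 →
      P {ω | n * (2 * ε) ≤ s₀ * (∑ t ∈ Finset.range n, (z ⬝ᵥ x t ω) ^ 2
        - n * (z ⬝ᵥ (Q *ᵥ z)))}
      ≤ ENNReal.ofReal (2 * Real.exp (-(n * η * D ^ 3 * ε ^ 2 / 160))) := by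
    intro z hz s₀ hs₀
    have h1 := h.measure_sum_sq_deviation_le hst z (by norm_num : (0 : ℝ) < 4) hz
      (by linarith : 0 < 2 * ε) (by linarith) n hs₀
    have e1 : n * η * D ^ 3 * (2 * ε) ^ 2 / (40 * 4 ^ 2) = n * η * D ^ 3 * ε ^ 2 / 160 := by
      ring
    rwa [e1] at h1
  have hsub : {ω | ε < |empCov n (fun t => x t ω) i j - Q i j|}
      ⊆ (({ω | n * (2 * ε) ≤ 1 * (∑ t ∈ Finset.range n, (u ⬝ᵥ x t ω) ^ 2
            - n * (u ⬝ᵥ (Q *ᵥ u)))} ∪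
          {ω | n * (2 * ε) ≤ -1 * (∑ t ∈ Finset.range n, (u ⬝ᵥ x t ω) ^ 2
            - n * (u ⬝ᵥ (Q *ᵥ u)))}) ∪
        {ω | n * (2 * ε) ≤ 1 * (∑ t ∈ Finset.range n, (v ⬝ᵥ x t ω) ^ 2
            - n * (v ⬝ᵥ (Q *ᵥ v)))}) ∪
        {ω | n * (2 * ε) ≤ -1 * (∑ t ∈ Finset.range n, (v ⬝ᵥ x t ω) ^ 2
            - n * (v ⬝ᵥ (Q *ᵥ v)))} := by
    intro ω hω
    simp only [Set.mem_ofPred_eq] at hω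
    by_contra hcon
    simp only [Set.mem_union, Set.mem_ofPred_eq, not_or, not_le] at hcon
    obtain ⟨⟨⟨h1, h2⟩, h3⟩, h4⟩ := hcon
    have h5 := sum_mul_eq_polarization n (fun t => x t ω) i j
    change _ = ∑ t ∈ Finset.range n, (u ⬝ᵥ x t ω) ^ 2
      - ∑ t ∈ Finset.range n, (v ⬝ᵥ x t ω) ^ 2 at h5
    have h6 : 4 * (n * Q i j) = n * (u ⬝ᵥ (Q *ᵥ u)) - n * (v ⬝ᵥ (Q *ᵥ v)) := by
      rw [← mul_sub, hQuv]; ring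
    have h7 : |n * (empCov n (fun t => x t ω) i j - Q i j)| ≤ n * ε := by
      rw [abs_le]
      constructor <;> linarith
    rw [abs_mul, abs_of_pos hn0] at h7
    exact absurd (le_of_mul_le_mul_left h7 hn0) (not_le.2 hω)
  have hone : |(1 : ℝ)| = 1 := abs_one
  have hneg : |(-1 : ℝ)| = 1 := by simp
  set B := Real.exp (-(n * η * D ^ 3 * ε ^ 2 / 160)) with hB
  have hB0 : 0 ≤ 2 * B := by positivity
  have e8 : ENNReal.ofReal (8 * B) = ENNReal.ofReal (2 * B) + ENNReal.ofReal (2 * B)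
      + ENNReal.ofReal (2 * B) + ENNReal.ofReal (2 * B) := by
    rw [← ENNReal.ofReal_add hB0 hB0, ← ENNReal.ofReal_add (by positivity) hB0,
      ← ENNReal.ofReal_add (by positivity) hB0]
    congr 1
    ring
  rw [e8]
  refine (measure_mono hsub).trans ((measure_union_le _ _).trans ?_)
  refine add_le_add ((measure_union_le _ _).trans ?_) (key v hv _ hneg)
  refine add_le_add ((measure_union_le _ _).trans ?_) (key v hv _ hone)
  exact add_le_add (key u hu _ hone) (key u hu _ hneg)

/-- The exponential supermartingale of the noise against a coordinate of the path. -/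
lemma lintegral_exp_martingale_le_one (h : StationaryTrajectory P η Θ x w) (hη : 0 < η)
    (r j : Fin p) (c : ℝ) (n : ℕ) :
    ∫⁻ ω, ENNReal.ofReal (Real.exp (∑ t ∈ Finset.range n,
        (c * (w (t + 1) ω r * x t ω j) - c ^ 2 * η / 2 * x t ω j ^ 2))) ∂P ≤ 1 := by
  induction n with
  | zero => simp
  | succ n ih =>
    -- Conditioning on the past requires a function of the path alone, so earlier noise is recovered
    -- as the increment beyond the drift.
    let noise : (ℕ → Fin p → ℝ) → ℕ → ℝ := fun z t => z (t + 1) r - ((1 + η • Θ) *ᵥ z t) r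
    have hnoise : ∀ ω t, t < n → noise (fun s => x (min s n) ω) t = w (t + 1) ω r := by
      intro ω t ht
      simp only [noise]
      rw [min_eq_left (by omega : t + 1 ≤ n), min_eq_left ht.le, h.step_eq]
      simp
    let G : (ℕ → Fin p → ℝ) → (Fin p → ℝ) → ENNReal := fun z y =>
      ENNReal.ofReal (Real.exp (∑ t ∈ Finset.range n,
        (c * (noise z t * z t j) - c ^ 2 * η / 2 * z t j ^ 2) - c ^ 2 * η / 2 * z n j ^ 2)) *
      ENNReal.ofReal (Real.exp (c * z n j * y r))
    have hmul : ∀ t, Measurable fun z : (ℕ → Fin p → ℝ) × (Fin p → ℝ) =>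
        ((1 + η • Θ) *ᵥ z.1 t) r := fun t =>
      (measurable_pi_apply r).comp (measurable_mulVec_left _
        ((measurable_pi_apply t).comp measurable_fst))
    have hG : Measurable (Function.uncurry G) := by
      simp only [G, noise, Function.uncurry_def]
      fun_prop
    have hsum : ∀ ω, ∑ t ∈ Finset.range n, (c * (noise (fun s => x (min s n) ω) t
          * x (min t n) ω j) - c ^ 2 * η / 2 * x (min t n) ω j ^ 2)
        = ∑ t ∈ Finset.range n,
          (c * (w (t + 1) ω r * x t ω j) - c ^ 2 * η / 2 * x t ω j ^ 2) := fun ω =>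
      Finset.sum_congr rfl fun t ht => by
        have ht' := Finset.mem_range.1 ht
        rw [hnoise ω t ht', min_eq_left ht'.le]
    have e1 : ∀ ω, ENNReal.ofReal (Real.exp (∑ t ∈ Finset.range (n + 1),
          (c * (w (t + 1) ω r * x t ω j) - c ^ 2 * η / 2 * x t ω j ^ 2)))
        = G (fun s => x (min s n) ω) (w (n + 1) ω) := by
      intro ω
      simp only [G]
      rw [← ENNReal.ofReal_mul (Real.exp_pos _).le, ← Real.exp_add, hsum, min_self,
        Finset.sum_range_succ]
      congr 2
      ring
    simp only [e1]
    rw [h.lintegral_step n hG]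
    refine le_trans (lintegral_mono fun ω => ?_) ih
    simp only [G]
    have hw := h.meas_noise n
    rw [lintegral_const_mul _ (by fun_prop), h.lintegral_exp_mul_noise hη, hsum, min_self,
      ← ENNReal.ofReal_mul (Real.exp_pos _).le, ← Real.exp_add]
    refine ENNReal.ofReal_le_ofReal (Real.exp_le_exp.2 (le_of_eq ?_))
    ring

/-- Tail bound for the gradient on the event that the empirical variance is under control. -/
lemma measure_empGrad_le (h : StationaryTrajectory P η Θ x w) (hη : 0 < η) (hD : 0 < D) {n : ℕ}
    (hn : n ≠ 0) (r j : Fin p) {a : ℝ} (ha : 0 < a) :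
    P {ω | a < |empGrad η n (fun t => w (t + 1) ω r) (fun t => x t ω) j| ∧
        empCov n (fun t => x t ω) j j ≤ 2 / D}
      ≤ ENNReal.ofReal (2 * Real.exp (-(n * η * D * a ^ 2 / 4))) := by
  have hn0 : (0 : ℝ) < n := by exact_mod_cast Nat.pos_of_ne_zero hn
  have hmx : ∀ t i, Measurable fun ω => x t ω i := fun t i =>
    (measurable_pi_apply i).comp (h.measurable_apply t)
  have hmw : ∀ t i, Measurable fun ω => w (t + 1) ω i := fun t i =>
    (measurable_pi_apply i).comp (h.meas_noise t)
  -- The tilt `a * D / 2` is optimal for empirical variance `2 / D`: the gain `n η D a² / 2` loses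
  -- half of itself to the compensator.
  have key : ∀ s₀ : ℝ, |s₀| = 1 →
      P {ω | n * η * D * a ^ 2 / 4 ≤ ∑ t ∈ Finset.range n,
        (s₀ * (a * D / 2) * (w (t + 1) ω r * x t ω j)
          - (s₀ * (a * D / 2)) ^ 2 * η / 2 * x t ω j ^ 2)}
      ≤ ENNReal.ofReal (Real.exp (-(n * η * D * a ^ 2 / 4))) := by
    intro s₀ _
    have h1 := h.lintegral_exp_martingale_le_one hη r j (s₀ * (a * D / 2)) n
    have h2 := measure_ge_le_of_lintegral_exp_le (b := 0) (c := n * η * D * a ^ 2 / 4)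
      (by fun_prop) (h1.trans (by simp))
    rwa [zero_sub] at h2
  have hone : |(1 : ℝ)| = 1 := abs_one
  have hneg : |(-1 : ℝ)| = 1 := by simp
  have hsub : {ω | a < |empGrad η n (fun t => w (t + 1) ω r) (fun t => x t ω) j| ∧
        empCov n (fun t => x t ω) j j ≤ 2 / D}
      ⊆ {ω | n * η * D * a ^ 2 / 4 ≤ ∑ t ∈ Finset.range n,
        (1 * (a * D / 2) * (w (t + 1) ω r * x t ω j)
          - (1 * (a * D / 2)) ^ 2 * η / 2 * x t ω j ^ 2)} ∪
        {ω | n * η * D * a ^ 2 / 4 ≤ ∑ t ∈ Finset.range n,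
        (-1 * (a * D / 2) * (w (t + 1) ω r * x t ω j)
          - (-1 * (a * D / 2)) ^ 2 * η / 2 * x t ω j ^ 2)} := by
    rintro ω ⟨h1, h2⟩
    have e1 : ∑ t ∈ Finset.range n, w (t + 1) ω r * x t ω j
        = n * η * empGrad η n (fun t => w (t + 1) ω r) (fun t => x t ω) j := by
      rw [empGrad]; field_simp
    have e2 : ∑ t ∈ Finset.range n, x t ω j ^ 2
        = n * empCov n (fun t => x t ω) j j := by
      rw [empCov]; field_simp
    have e3 : ∀ s₀ : ℝ, |s₀| = 1 → ∑ t ∈ Finset.range n,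
        (s₀ * (a * D / 2) * (w (t + 1) ω r * x t ω j)
          - (s₀ * (a * D / 2)) ^ 2 * η / 2 * x t ω j ^ 2)
        = a * D / 2 * (n * η) *
            (s₀ * empGrad η n (fun t => w (t + 1) ω r) (fun t => x t ω) j)
          - a ^ 2 * D ^ 2 / 8 * (n * η) * empCov n (fun t => x t ω) j j := by
      intro s₀ hs₀
      rw [Finset.sum_sub_distrib, ← Finset.mul_sum, ← Finset.mul_sum, e1, e2, mul_pow,
        ← sq_abs s₀, hs₀]
      ring
    have h3 : a ^ 2 * D ^ 2 / 8 * (n * η) * empCov n (fun t => x t ω) j j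
        ≤ n * η * D * a ^ 2 / 4 := by
      calc _ ≤ a ^ 2 * D ^ 2 / 8 * (n * η) * (2 / D) := by gcongr
        _ = _ := by field_simp; norm_num
    have hpos : 0 ≤ a * D / 2 * (n * η) := by positivity
    simp only [Set.mem_union, Set.mem_ofPred_eq]
    rw [e3 1 hone, e3 (-1) hneg]
    rcases lt_abs.1 h1 with h4 | h4
    · left
      have := mul_le_mul_of_nonneg_left h4.le hpos
      rw [one_mul]
      nlinarith
    · right
      have := mul_le_mul_of_nonneg_left h4.le hpos
      rw [neg_one_mul]
      nlinarith
  refine (measure_mono hsub).trans ((measure_union_le _ _).trans ?_)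
  rw [two_mul, ENNReal.ofReal_add (Real.exp_pos _).le (Real.exp_pos _).le]
  exact add_le_add (key 1 hone) (key (-1) hneg)

end StationaryTrajectory

/-! ### Numerical bounds and the theorem -/

lemma mul_sq_div_le {p k δ : ℝ} (hp : 1 ≤ p) (hk : 3 ≤ k) (hδ : 0 < δ) (hδ1 : δ < 1) :
    p * (8 * (δ / (4 * p * k)) ^ 2) ≤ δ / 18 := by
  have hk2 : 9 ≤ k ^ 2 := by nlinarith
  have hpk : 9 ≤ p * k ^ 2 := by nlinarith
  have e1 : p * (8 * (δ / (4 * p * k)) ^ 2) = δ * δ / (2 * (p * k ^ 2)) := by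
    field_simp; norm_num
  rw [e1]
  exact div_le_div₀ hδ.le (by nlinarith) (by norm_num) (by linarith)

lemma mul_mul_sq_div_le {p k δ : ℝ} (hp : 1 ≤ p) (hk : 3 ≤ k) (hδ : 0 < δ) (hδ1 : δ < 1) :
    k * (p * (8 * (δ / (4 * p * k)) ^ 2)) ≤ δ / 6 := by
  have hpk : 3 ≤ p * k := by nlinarith
  have e1 : k * (p * (8 * (δ / (4 * p * k)) ^ 2)) = δ * δ / (2 * (p * k)) := by
    field_simp; norm_num
  rw [e1]
  exact div_le_div₀ hδ.le (by nlinarith) (by norm_num) (by linarith)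

lemma mul_log_lt_of_sample_size {k D b L c M : ℝ} (hD : 0 < D) (hL : 0 < L)
    (h : 10 ^ 4 * k ^ 2 * (k * (D ^ 2)⁻¹ + (b ^ 2)⁻¹) * L < M * (c ^ 2 * D)) :
    10 ^ 4 * k ^ 3 * L < M * (c ^ 2 * D ^ 3) := by
  have h1 : 10 ^ 4 * k ^ 2 * (k * (D ^ 2)⁻¹) * L < M * (c ^ 2 * D) := by
    refine lt_of_le_of_lt ?_ h
    gcongr
    exact le_add_of_nonneg_right (by positivity)
  have h2 := mul_lt_mul_of_pos_right h1 (pow_pos hD 2)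
  have e1 : 10 ^ 4 * k ^ 2 * (k * (D ^ 2)⁻¹) * L * D ^ 2 = 10 ^ 4 * k ^ 3 * L := by
    field_simp
  linarith

lemma sq_mul_log_lt_of_sample_size {k D b L M : ℝ} (hb : 0 < b) (hL : 0 < L)
    (h : 10 ^ 4 * k ^ 2 * (k * (D ^ 2)⁻¹ + (b ^ 2)⁻¹) * L < M) (hk : 0 ≤ k) :
    10 ^ 4 * k ^ 2 * L < M * b ^ 2 := by
  have h1 : 10 ^ 4 * k ^ 2 * (b ^ 2)⁻¹ * L < M := by
    refine lt_of_le_of_lt ?_ h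
    gcongr
    exact le_add_of_nonneg_left (by positivity)
  have h2 := mul_lt_mul_of_pos_right h1 (pow_pos hb 2)
  have e1 : 10 ^ 4 * k ^ 2 * (b ^ 2)⁻¹ * L * b ^ 2 = 10 ^ 4 * k ^ 2 * L := by
    field_simp
  linarith

theorem theorem4 {Ω : Type*} [MeasurableSpace Ω] (P : Measure Ω) [IsProbabilityMeasure P]
    (k p n : ℕ) (hk : 3 ≤ k)
    (θmin D η α Cmin δ : ℝ) (hθmin : 0 < θmin) (hD : 0 < D) (hη : 0 < η)
    (hα : 0 < α) (hCmin : 0 < Cmin) (hδ : 0 < δ) (hδ1 : δ < 1)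
    (Θ Q : Matrix (Fin p) (Fin p) ℝ) (r : Fin p)
    (hΘ : SparseClass k p θmin D η Θ)
    (hQ : LyapunovEq η Θ Q)
    (hA1 : RestrictedConvexity Q (rowSupport Θ r) Cmin)
    (hA2 : Irrepresentability Q (rowSupport Θ r) α)
    (x w : ℕ → Ω → Fin p → ℝ)
    (hx : StationaryTrajectory P η Θ x w)
    (hn : 10 ^ 4 * (k : ℝ) ^ 2 * (k * (D ^ 2)⁻¹ + (θmin ^ 2)⁻¹) / (α ^ 2 * D * Cmin ^ 2)
        * Real.log (4 * p * k / δ) < n * η)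
    (lam : ℝ) (hlam : lam = Real.sqrt (36 * Real.log (4 * p / δ) / (D * α ^ 2 * (n * η)))) :
    0 < lam ∧
      1 - δ < P.real {ω | RlsRecoversSign η n (fun t => x t ω) r lam (fun j => Θ r j)} := by
  classical
  obtain ⟨S, hSdef⟩ : ∃ S, S = rowSupport Θ r := ⟨_, rfl⟩
  rw [← hSdef] at hA1 hA2
  have hst := stableLyapunov_of_sparseClass hη hD hΘ hQ
  have hsymm := hst.symm
  have hrS : r ∈ S := hSdef ▸ mem_rowSupport_self hη hD hΘ r
  have hp : (1 : ℝ) ≤ p := by exact_mod_cast Nat.one_le_of_lt r.2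
  have hk3 : (3 : ℝ) ≤ k := by exact_mod_cast hk
  have hcard : (S.card : ℝ) ≤ k := by rw [hSdef]; exact_mod_cast hΘ.row_card r
  have hα1 : α ≤ 1 := by
    have h1 : infOpNorm _ ≤ 1 - α := hA2
    linarith [infOpNorm_nonneg (Q.toBlock (· ∉ S) (· ∈ S) * (Q.toBlock (· ∈ S) (· ∈ S))⁻¹)]
  have hdiag : ∀ j, Q j j ≤ 1 / D := fun j => by
    simpa using hst.quad_le (Pi.single j 1)
  -- Test convexity on the basis vector at `r`, which lies in `S`: `Cmin ≤ Q r r ≤ 1 / D`. This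
  -- makes `ε` and `1 / D` admissible deviations.
  have hCD : Cmin * D ≤ 1 := by
    have h1 := hA1.le_quadForm hsymm (Pi.single r 1) fun j hj => by
      have hjr : j ≠ r := fun e => hj (e.symm ▸ hrS)
      simp [hjr]
    simp only [Pi.single_apply, ite_pow, one_pow, ne_eq, OfNat.ofNat_ne_zero, not_false_eq_true,
      zero_pow, ite_mul, one_mul, zero_mul, Finset.sum_ite_eq', Finset.mem_univ, if_true,
      mul_one] at h1
    exact (le_div_iff₀ hD).1 (h1.trans (hdiag r))
  set L := Real.log (4 * p * k / δ) with hL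
  set L' := Real.log (4 * p / δ) with hL'
  have hL'0 : 0 < L' := Real.log_pos (by rw [lt_div_iff₀ hδ]; linarith)
  have hLL : L' ≤ L := Real.log_le_log (by positivity) 
    (div_le_div_of_nonneg_right (by nlinarith) hδ.le)
  have hL0 : 0 < L := hL'0.trans_le hLL
  have hnη : 0 < n * η := lt_of_le_of_lt (by positivity) hn
  have hn0 : n ≠ 0 := by
    rintro rfl
    simp at hnη
  have hsplit : 10 ^ 4 * (k : ℝ) ^ 2 * (k * (D ^ 2)⁻¹ + (θmin ^ 2)⁻¹) * L
      < n * η * (α ^ 2 * D * Cmin ^ 2) := by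
    rw [div_mul_eq_mul_div, div_lt_iff₀ (by positivity)] at hn
    exact hn
  have hcov : 10 ^ 4 * (k : ℝ) ^ 3 * L < n * η * (α ^ 2 * D ^ 3 * Cmin ^ 2) := by
    have h1 := mul_log_lt_of_sample_size (c := α * Cmin) hD hL0
      (hsplit.trans_eq (by ring : _ = n * η * ((α * Cmin) ^ 2 * D)))
    linarith
  have hsig := sq_mul_log_lt_of_sample_size hθmin hL0 hsplit (by positivity)
  have hlam0 : 0 < lam := by rw [hlam]; positivity
  have hlam2 : lam ^ 2 * (D * α ^ 2 * (n * η)) = 36 * L' := by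
    rw [hlam, Real.sq_sqrt (by positivity)]
    field_simp
  refine ⟨hlam0, ?_⟩
  set ε := α * Cmin / (9 * k) with hε
  have hε0 : 0 < ε := by positivity
  have hDε : D * ε ≤ 2 := by
    rw [hε, ← mul_div_assoc, div_le_iff₀ (by positivity)]
    nlinarith
  -- Here the `θmin` term of the sample size condition is spent; after squaring, the constant is `81
  -- = (9/4) * 36`.
  have hθlam : 3 / 2 * k * lam < θmin * Cmin := by
    refine lt_of_pow_lt_pow_left₀ 2 (by positivity) ?_
    have h1 : 0 < D * α ^ 2 * (n * η) := by positivity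
    refine lt_of_mul_lt_mul_right ?_ h1.le
    calc (3 / 2 * k * lam) ^ 2 * (D * α ^ 2 * (n * η))
        = 9 / 4 * k ^ 2 * (lam ^ 2 * (D * α ^ 2 * (n * η))) := by ring
      _ = 81 * (k ^ 2 * L') := by rw [hlam2]; ring
      _ ≤ 10 ^ 4 * (k ^ 2 * L) := by gcongr; norm_num
      _ < n * η * (α ^ 2 * D * Cmin ^ 2) * θmin ^ 2 := by linarith
      _ = _ := by ring
  have hexpL : Real.exp (-L) = δ / (4 * p * k) := by
    rw [Real.exp_neg, hL, Real.exp_log (by positivity), inv_div]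
  have hexpL' : Real.exp (-L') = δ / (4 * p) := by
    rw [Real.exp_neg, hL', Real.exp_log (by positivity), inv_div]
  have hexp2L : Real.exp (-(2 * L)) = (δ / (4 * p * k)) ^ 2 := by
    rw [← hexpL, ← Real.exp_nat_mul]; congr 1; push_cast; ring
  let y : Ω → ℕ → Fin p → ℝ := fun ω t => x t ω
  let ξ : Ω → ℕ → ℝ := fun ω t => w (t + 1) ω r
  let badCov : Fin p → Fin p → Set Ω := fun i j => {ω | ε < |empCov n (y ω) i j - Q i j|}
  let badVar : Fin p → Set Ω := fun j => {ω | 1 / D < |empCov n (y ω) j j - Q j j|}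
  let badGrad : Fin p → Set Ω := fun j =>
    {ω | lam * α / 3 < |empGrad η n (ξ ω) (y ω) j| ∧ empCov n (y ω) j j ≤ 2 / D}
  have hbadCov : ∀ i j, P.real (badCov i j) ≤ 8 * (δ / (4 * p * k)) ^ 2 := by
    intro i j
    have h1 := hx.measure_empCov_deviation_le hst hn0 i j hε0 hDε
    refine (ENNReal.toReal_le_of_le_ofReal (by positivity) h1).trans ?_
    rw [← hexp2L]
    gcongr
    have e1 : n * η * D ^ 3 * ε ^ 2 / 160
        = n * η * (α ^ 2 * D ^ 3 * Cmin ^ 2) / (12960 * k ^ 2) := by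
      rw [hε]; field_simp; norm_num
    rw [e1, le_div_iff₀ (by positivity)]
    -- The exponent exceeds `10⁴ k L / 12960`, with `12960 = 160 * 81`; `k ≥ 3` makes this at least
    -- `2 * L`, which yields the square of `δ / (4pk)`.
    have h2 : (k : ℝ) ^ 2 * L * 3 ≤ k ^ 2 * L * k := by gcongr
    linarith [h2, mul_pos (pow_pos (by linarith : (0 : ℝ) < k) 2) hL0]
  have hbadVar : ∀ j, P.real (badVar j) ≤ 8 * (δ / (4 * p * k)) ^ 2 := by
    intro j
    have h1 := hx.measure_empCov_deviation_le hst hn0 j j (ε := 1 / D) (by positivity)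
      (by rw [mul_one_div_cancel hD.ne']; norm_num)
    refine (ENNReal.toReal_le_of_le_ofReal (by positivity) h1).trans ?_
    rw [← hexp2L]
    gcongr
    have e1 : n * η * D ^ 3 * (1 / D) ^ 2 / 160 = n * η * D / 160 := by field_simp
    rw [e1, le_div_iff₀ (by norm_num)]
    have h2 : α * (Cmin * D) ≤ 1 := mul_le_one₀ hα1 (by positivity) hCD
    have h3 : n * η * (α ^ 2 * D ^ 3 * Cmin ^ 2) ≤ n * η * D := by
      calc n * η * (α ^ 2 * D ^ 3 * Cmin ^ 2) = n * η * D * (α * (Cmin * D)) ^ 2 := by ring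
        _ ≤ n * η * D * 1 ^ 2 := by gcongr
        _ = _ := by ring
    have h4 : (3 : ℝ) ^ 3 * L ≤ k ^ 3 * L := by gcongr
    linarith
  have hbadGrad : ∀ j, P.real (badGrad j) ≤ 2 * (δ / (4 * p)) := by
    intro j
    have h1 := hx.measure_empGrad_le hη hD hn0 r j (a := lam * α / 3) (by positivity)
    refine (ENNReal.toReal_le_of_le_ofReal (by positivity) h1).trans (le_of_eq ?_)
    -- The `36` in `lam` is `9 * 4`, chosen for this equality.
    have e1 : n * η * D * (lam * α / 3) ^ 2 / 4 = L' := by linarith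
    rw [e1, hexpL']
  let bad : Set Ω := ((⋃ i ∈ S, ⋃ j ∈ Finset.univ, badCov i j) ∪ ⋃ j ∈ Finset.univ, badVar j) ∪
    ⋃ j ∈ Finset.univ, badGrad j
  -- The three families cost at most `δ/6`, `δ/18` and `δ/2`.
  have hbad : P.real bad < δ := by
    have h1 : P.real (⋃ i ∈ S, ⋃ j ∈ Finset.univ, badCov i j)
        ≤ k * (p * (8 * (δ / (4 * p * k)) ^ 2)) := by
      refine (measureReal_biUnion_finset_le _ _).trans ((Finset.sum_le_card_nsmul _ _
        (p * (8 * (δ / (4 * p * k)) ^ 2)) fun i _ => ?_).trans ?_)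
      · refine (measureReal_biUnion_finset_le _ _).trans ((Finset.sum_le_card_nsmul _ _ _
          fun j _ => hbadCov i j).trans ?_)
        simp
      · rw [nsmul_eq_mul]
        gcongr
    have h2 : P.real (⋃ j ∈ Finset.univ, badVar j) ≤ p * (8 * (δ / (4 * p * k)) ^ 2) := by
      refine (measureReal_biUnion_finset_le _ _).trans ((Finset.sum_le_card_nsmul _ _ _
        fun j _ => hbadVar j).trans ?_)
      simp
    have h3 : P.real (⋃ j ∈ Finset.univ, badGrad j) ≤ p * (2 * (δ / (4 * p))) := by
      refine (measureReal_biUnion_finset_le _ _).trans ((Finset.sum_le_card_nsmul _ _ _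
        fun j _ => hbadGrad j).trans ?_)
      simp
    have h4 := mul_sq_div_le hp hk3 hδ hδ1
    have h5 := mul_mul_sq_div_le hp hk3 hδ hδ1
    have h6 : p * (2 * (δ / (4 * p))) = δ / 2 := by field_simp; norm_num
    have h7 : P.real bad ≤ _ := measureReal_union_le _ _
    have h8 := measureReal_union_le (μ := P) (⋃ i ∈ S, ⋃ j ∈ Finset.univ, badCov i j)
      (⋃ j ∈ Finset.univ, badVar j)
    linarith
  -- A cover and subadditivity suffice, so measurability of the recovery event is not needed.
  have hcover : Set.univ ⊆
      {ω | RlsRecoversSign η n (fun t => x t ω) r lam (fun j => Θ r j)} ∪ bad := by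
    intro ω _
    by_contra hcon
    rw [Set.mem_union, not_or] at hcon
    obtain ⟨hE, hB⟩ := hcon
    simp only [bad, badCov, badVar, badGrad, Set.mem_union, Set.mem_iUnion, Set.mem_ofPred_eq,
      Finset.mem_univ, not_or, not_exists, not_and, not_lt, forall_true_left] at hB
    obtain ⟨⟨h1, h2⟩, h3⟩ := hB
    refine hE (rlsRecoversSign_of_close hη.ne' hn0 (ξ := ξ ω) hlam0 (fun t => ?_)
      (S := S) (fun j => by simp [hSdef, rowSupport]) (by linarith) hcard hα hα1 hCmin
      (fun j hj => hΘ.entry_ge r j hj) (fun u hu => hA1.le_quadForm hsymm u hu)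
      (fun j hj => hA2.exists_coeff hCmin hA1 hsymm j hj) (fun j => ?_) h1 hθlam)
    · rw [hx.step]
      simp only [ξ, Pi.add_apply, Pi.smul_apply, smul_eq_mul, Matrix.mulVec, dotProduct]
      ring
    · by_contra hj
      refine h3 j (not_le.1 hj) ?_
      have h4 := (abs_le.1 (h2 j)).2
      have h5 := hdiag j
      have e1 : 2 / D = 1 / D + 1 / D := by ring
      linarith
  have h1 := measureReal_mono (μ := P) hcover
  have h2 := h1.trans (measureReal_union_le _ _)
  rw [probReal_univ] at h2
  linarith
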